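/- Let $n\ge 1$, $0<s<\min(1,n/2)$, and let $\Omega\subset\mathbb R^n$ be an open set that is bounded in one direction, i.e. $\Omega\subset A(\mathbb R^{n-k}\times\omega)$ for some $0<k\le n$, some bounded open set $\omega\subset\mathbb R^k$ and some rigid Euclidean motion $A$. Put $\Omega_e=\mathbb R^n\setminus\overline\Omega$. All functions are real-valued. For $t\in\mathbb R$ and $1\le p\le\infty$ let $H^{t,p}(\mathbb R^n)$ be the Bessel potential space of all tempered distributions $u$ with $\langle D\rangle^t u\in L^p(\mathbb R^n)$, where $\langle D\rangle^t$ is the Fourier multiplier with symbol $(1+|\xi|^2)^{t/2}$; its norm is $\|\langle D\rangle^t u\|_{L^p(\mathbb R^n)}$. Let $H^s(\mathbb R^n)=H^{s,2}(\mathbb R^n)$, and let $\widetilde H^s(\Omega)$ be the closure of $C_c^\infty(\Omega)$ in $H^s(\mathbb R^n)$. Let $\gamma_1,\gamma_2\in L^\infty(\mathbb R^n)$ satisfy $\gamma_1,\gamma_2\ge\gamma_0$ a.e. in $\mathbb R^n$ for some constant $\gamma_0>0$ and $\gamma_j^{1/2}-1\in H^{2s,\frac n{2s}}(\mathbb R^n)$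 for $j=1,2$. With $$\nabla^su(x,y)=\sqrt{\tfrac{C_{n,s}}2}\,\frac{u(x)-u(y)}{|x-y|^{n/2+s+1}}(x-y),\qquad C_{n,s}=\frac{4^s\,\Gamma(n/2+s)}{\pi^{n/2}\,|\Gamma(-s)|},$$ define, for $u,v\in H^s(\mathbb R^n)$, $$B_{\gamma}(u,v)=\int_{\mathbb R^{2n}}\gamma^{1/2}(x)\gamma^{1/2}(y)\,\nabla^su(x,y)\cdot\nabla^sv(x,y)\,dx\,dy .$$ For $f\in H^s(\mathbb R^n)$ let $u_f\in H^s(\mathbb R^n)$ be the unique weak solution of $\operatorname{div}_s(\Theta_\gamma\cdot\nabla^su)=0$ in $\Omega$, $u=f$ in $\Omega_e$, where $\Theta_\gamma(x,y)=\gamma^{1/2}(x)\gamma^{1/2}(y)\mathbf 1_{n\times n}$; that is, $u_f-f\in\widetilde H^s(\Omega)$ and $B_\gamma(u_f,\phi)=0$ for all $\phi\in\widetilde H^s(\Omega)$. The exterior DN map $\Lambda_\gamma\colon X\to X^*$, $X=H^s(\mathbb R^n)/\widetilde H^s(\Omega)$, is given by $\langle\Lambda_\gamma f,g\rangle=B_\gamma(u_f,g)$.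 Let $W\subset\Omega_e$ be a nonempty open set such that $\gamma_1,\gamma_2\in C(W)$. If $\Lambda_{\gamma_1}f|_W=\Lambda_{\gamma_2}f|_W$ for all $f\in C_c^\infty(W)$, that is, if $\langle\Lambda_{\gamma_1}f,g\rangle=\langle\Lambda_{\gamma_2}f,g\rangle$ for all $f,g\in C_c^\infty(W)$, then $\gamma_1=\gamma_2$ in $W$. -/

import Mathlib

open MeasureTheory Filter Topology
open scoped ENNReal ContDiff SchwartzMap

noncomputable section

namespace FracCalderon

/-- The Euclidean space `ℝⁿ`. -/
abbrev Eucl (n : ℕ) : Type := EuclideanSpace ℝ (Fin n)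

variable {n : ℕ}

/-! ### Bessel potential spaces of real-valued functions -/

/-- The function `u` is (absolutely) integrable against every Schwartz function, and the tempered
distribution it defines is `U`. In particular `u` is a.e. strongly measurable. -/
def Represents (u : Eucl n → ℝ) (U : 𝓢'(Eucl n, ℂ)) : Prop :=
  ∀ φ : 𝓢(Eucl n, ℂ),
    Integrable (fun x => φ x * (u x : ℂ)) ∧ U φ = ∫ x, φ x * (u x : ℂ)

/-- `⟨D⟩ᵗ u = g` with `g ∈ Lᵖ(ℝⁿ)`. With Mathlib's Fourier transform, `besselPotential` is
`(1 - (2π)⁻² Δ)^(t/2)`; replacing it by `(1 - Δ)^(t/2)` changes the norm below only to an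
equivalent one. -/
def HasBessel (t : ℝ) (p : ℝ≥0∞) [Fact (1 ≤ p)] (u : Eucl n → ℝ)
    (g : Lp ℂ p (volume : Measure (Eucl n))) : Prop :=
  ∃ U : 𝓢'(Eucl n, ℂ), Represents u U ∧ TemperedDistribution.besselPotential (Eucl n) ℂ t U = g

/-- The function `u` belongs to the Bessel potential space `H^{t,p}(ℝⁿ)`, `1 ≤ p ≤ ∞`. -/
def MemBessel (t : ℝ) (p : ℝ≥0∞) (u : Eucl n → ℝ) : Prop :=
  ∃ (_ : Fact (1 ≤ p)) (U : 𝓢'(Eucl n, ℂ)),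
    Represents u U ∧ TemperedDistribution.MemSobolev t p U

/-- The function `u` belongs to `Hˢ(ℝⁿ) = H^{s,2}(ℝⁿ)`. -/
def MemHs (s : ℝ) (u : Eucl n → ℝ) : Prop := MemBessel s 2 u

/-- The norm `‖u‖_{Hˢ} = ‖⟨D⟩ˢ u‖_{L²}`, equal to `∞` if `u ∉ Hˢ(ℝⁿ)`. The infimum is over the at
most one `g ∈ L²` with `⟨D⟩ˢ u = g`. -/
def hsNorm (s : ℝ) (u : Eucl n → ℝ) : ℝ≥0∞ :=
  ⨅ (g : Lp ℂ 2 (volume : Measure (Eucl n))) (_ : HasBessel s 2 u g), ‖g‖ₑ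

/-- `f ∈ C_c^∞(U)`, extended by zero to `ℝⁿ`. -/
def IsTestFunction (U : Set (Eucl n)) (f : Eucl n → ℝ) : Prop :=
  ContDiff ℝ ∞ f ∧ HasCompactSupport f ∧ tsupport f ⊆ U

/-- `v ∈ H̃ˢ(Ω)`, the closure of `C_c^∞(Ω)` in `Hˢ(ℝⁿ)`. -/
def MemHsTilde (s : ℝ) (Ω : Set (Eucl n)) (v : Eucl n → ℝ) : Prop :=
  MemHs s v ∧
    ∀ ε : ℝ≥0∞, 0 < ε → ∃ φ, IsTestFunction Ω φ ∧ hsNorm s (fun x => v x - φ x) < ε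

/-! ### Domains -/

/-- The cylindrical domain `ℝⁿ⁻ᵏ × D ⊆ ℝⁿ` over `D ⊆ ℝᵏ`. -/
def cylinderDomain {k : ℕ} (hk : k ≤ n) (D : Set (Eucl k)) : Set (Eucl n) :=
  {x | WithLp.toLp 2 (fun i : Fin k => x ⟨n - k + i, by omega⟩) ∈ D}

/-- `Ω` is contained in the image of a cylindrical domain with bounded open base of dimension
`0 < k ≤ n` under a rigid motion. -/
def BoundedInOneDirection (Ω : Set (Eucl n)) : Prop :=
  ∃ (k : ℕ) (hk : k ≤ n) (D : Set (Eucl k)) (A : Eucl n ≃ᵃⁱ[ℝ] Eucl n),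
    0 < k ∧ IsOpen D ∧ Bornology.IsBounded D ∧ Ω ⊆ A '' cylinderDomain hk D

/-- The exterior `Ω_e = ℝⁿ \ closure Ω`. -/
def exterior (Ω : Set (Eucl n)) : Set (Eucl n) := (closure Ω)ᶜ

/-! ### The fractional conductivity equation -/

/-- The constant `C_{n,s} = 4ˢ Γ(n/2+s) / (π^{n/2} |Γ(-s)|)`. -/
def fracConst (n : ℕ) (s : ℝ) : ℝ :=
  4 ^ s * Real.Gamma ((n : ℝ) / 2 + s) / (Real.pi ^ ((n : ℝ) / 2) * |Real.Gamma (-s)|)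

/-- The fractional gradient `∇ˢu(x,y) = √(C_{n,s}/2) (u(x)-u(y)) |x-y|^{-(n/2+s+1)} (x-y)`. -/
def fracGrad (s : ℝ) (u : Eucl n → ℝ) (x y : Eucl n) : Eucl n :=
  (√(fracConst n s / 2) * ((u x - u y) / ‖x - y‖ ^ ((n : ℝ) / 2 + s + 1))) • (x - y)

/-- The bilinear form `B_γ(u,v) = ∫_{ℝ²ⁿ} Θ_γ ∇ˢu · ∇ˢv dx dy`, where the conductivity matrix
`Θ_γ(x,y) = γ^{1/2}(x) γ^{1/2}(y) 1_{n×n}` acts as a scalar. -/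
def condForm (s : ℝ) (γ : Eucl n → ℝ) (u v : Eucl n → ℝ) : ℝ :=
  ∫ z : Eucl n × Eucl n,
    inner ℝ ((√(γ z.1) * √(γ z.2)) • fracGrad s u z.1 z.2) (fracGrad s v z.1 z.2)

/-- `u` is a weak solution of `div_s(Θ_γ ∇ˢu) = 0` in `Ω`, `u = f` in `Ω_e`. -/
def IsWeakSolution (s : ℝ) (γ : Eucl n → ℝ) (Ω : Set (Eucl n)) (f u : Eucl n → ℝ) : Prop :=
  MemHs s u ∧ MemHsTilde s Ω (fun x => u x - f x) ∧
    ∀ φ, MemHsTilde s Ω φ → condForm s γ u φ = 0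

/-- The weak solution `u_f` with exterior value `f` (unique up to null sets when the problem is
well posed). -/
def solution (s : ℝ) (γ : Eucl n → ℝ) (Ω : Set (Eucl n)) (f : Eucl n → ℝ) : Eucl n → ℝ :=
  Classical.epsilon (IsWeakSolution s γ Ω f)

/-- The exterior DN map, `⟨Λ_γ f, g⟩ = B_γ(u_f, g)`, where `f, g ∈ Hˢ(ℝⁿ)` stand for their classes
in `X = Hˢ(ℝⁿ)/H̃ˢ(Ω)`. -/
def dnMap (s : ℝ) (γ : Eucl n → ℝ) (Ω : Set (Eucl n)) (f g : Eucl n → ℝ) : ℝ :=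
  condForm s γ (solution s γ Ω f) g

/-- The background deviation `m_γ = γ^{1/2} - 1`. -/
def backgroundDeviation (γ : Eucl n → ℝ) (x : Eucl n) : ℝ := √(γ x) - 1

end FracCalderon

end

/-! The diagonal values `⟨Λ_γ f, f⟩` for data concentrated near a point `x₀ ∈ W` already determine
`γ(x₀)`. Let `f` be a test function in a ball of radius `r` about `x₀`, where the ball of radius
`2r` lies in `W`, and write `u_f = f + v` with `v ∈ H̃ˢ(Ω)`. Then `B_γ(u_f, f) = B_γ(f, f) + B_γ(v,
f)`.

Since `v` vanishes a.e. outside `Ω`, the cross term involves only pairs of points at distance at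
least `r`. There the kernel `|x-y|^{-(n+2s)}` is integrable, so the cross term is `O(‖f‖²_{L²})`
(`abs_weak_solution_sub_energy_le`, `exists_gag_far_le`). By continuity of `γ` at `x₀`, the term
`B_γ(f, f)` equals `C_{n,s}/2 · γ(x₀)` times the squared Gagliardo seminorm of `f`, up to a small
multiple of that seminorm and again `O(‖f‖²_{L²})` (`abs_energy_sub_le`). Rescaling a bump by `t`
multiplies the quotient of squared seminorm and squared `L²` norm by `t^{2s}`, so no bound of the
former by the latter holds (`not_gag_le_of_ball`). Equal DN maps with `γ₁(x₀) ≠ γ₂(x₀)` would give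
such a bound.

Two foundations are needed. The Bessel potential definition of `Hˢ` is matched with `L²` plus
Gagliardo seminorm by Plancherel: the symbol of the seminorm is a constant times `|ξ|^{2s}`
(`exists_symb_eq`, `memHs_iff`). Weak solutions exist by orthogonal projection in a weighted `L²`
space of increments, with a Poincaré inequality ensuring that limits of increments come from
`H̃ˢ(Ω)` (`exists_poincare`, `exists_weak_solution`). -/

noncomputable section

namespace FracCalderon

variable {n : ℕ}

open FourierTransform TemperedDistribution

/-! ### Sobolev spaces on the Fourier side -/

/-- The complex Hilbert space `L²(ℝⁿ)`. -/
abbrev L2 (n : ℕ) := Lp ℂ 2 (volume : Measure (Eucl n))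

/-- For `s ≥ 0` the symbol of `⟨D⟩^{-s}` is bounded by 1, so this inverse of `⟨D⟩ˢ` acts on `L²` by
multiplication on the Fourier side. -/
theorem besselPotential_neg_coe {s : ℝ} (hs : 0 ≤ s) (g : L2 n) :
    ∃ f : L2 n,
      besselPotential (Eucl n) ℂ (-s) (g : 𝓢'(Eucl n, ℂ)) = (f : 𝓢'(Eucl n, ℂ)) ∧
      (𝓕 f : L2 n) =ᵐ[volume] fun ξ => (((1 + ‖ξ‖ ^ 2) ^ (-s / 2) : ℝ) : ℂ) * (𝓕 g : L2 n) ξ := by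
  have hm : MemLp (fun ξ : Eucl n => (((1 + ‖ξ‖ ^ 2) ^ (-s / 2) : ℝ) : ℂ)) ⊤ volume := by
    refine memLp_top_of_bound (Continuous.aestronglyMeasurable ?_) 1 (ae_of_all _ fun ξ => ?_)
    · refine Complex.continuous_ofReal.comp (Continuous.rpow_const (by fun_prop) fun ξ => ?_)
      left; positivity
    · rw [Complex.norm_real, Real.norm_eq_abs, abs_of_nonneg (by positivity)]
      exact Real.rpow_le_one_of_one_le_of_nonpos (by simp) (by linarith)
  refine ⟨𝓕⁻ (hm.toLp _ • 𝓕 g : L2 n), ?_, ?_⟩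
  · rw [← Lp.fourierInv_toTemperedDistribution_eq,
      Lp.toTemperedDistribution_smul_eq (by fun_prop), besselPotential,
      TemperedDistribution.fourierMultiplierCLM_apply, Lp.fourier_toTemperedDistribution_eq]
  · rw [fourier_fourierInv_eq]
    filter_upwards [Lp.coeFn_lpSMul (r := 2) (hm.toLp _) (𝓕 g : L2 n), hm.coeFn_toLp] with ξ h1 h2
    rw [h1, Pi.smul_apply', h2, smul_eq_mul]

theorem Represents.locallyIntegrable {u : Eucl n → ℝ} {U : 𝓢'(Eucl n, ℂ)} (h : Represents u U) :
    LocallyIntegrable (fun x => (u x : ℂ)) volume := by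
  intro x
  -- This bump equals 1 on the closed unit ball about `x`, so testing against it gives integrability
  -- there.
  let b : ContDiffBump x := ⟨1, 2, one_pos, one_lt_two⟩
  have hg₁ : HasCompactSupport (Complex.ofRealCLM ∘ b) := b.hasCompactSupport.comp_left rfl
  have hg₂ : ContDiff ℝ ∞ (Complex.ofRealCLM ∘ b) := by
    exact Complex.ofRealCLM.contDiff.comp b.contDiff
  refine ⟨Metric.closedBall x 1, Metric.closedBall_mem_nhds x one_pos, ?_⟩
  have h1 := ((h (hg₁.toSchwartzMap hg₂)).1).integrableOn (s := Metric.closedBall x 1)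
  refine h1.congr_fun (fun y hy => ?_) measurableSet_closedBall
  have : b y = 1 := b.one_of_mem_closedBall hy
  simp [this]

theorem Represents.ae_eq {u : Eucl n → ℝ} {f : L2 n}
    (h : Represents u (f : 𝓢'(Eucl n, ℂ))) : (fun x => (u x : ℂ)) =ᵐ[volume] f := by
  refine ae_eq_of_integral_contDiff_smul_eq h.locallyIntegrable
    ((Lp.memLp f).locallyIntegrable one_le_two) fun g hg hc => ?_
  have hg₁ : HasCompactSupport (Complex.ofRealCLM ∘ g) := hc.comp_left rfl
  have hg₂ : ContDiff ℝ ∞ (Complex.ofRealCLM ∘ g) := by fun_prop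
  have h1 := (h (hg₁.toSchwartzMap hg₂)).2
  rw [Lp.toTemperedDistribution_apply] at h1
  simpa using h1.symm

theorem represents_toLp {u : Eucl n → ℝ} (h : MemLp (fun x => (u x : ℂ)) 2 volume) :
    Represents u ((h.toLp _ : L2 n) : 𝓢'(Eucl n, ℂ)) := by
  intro φ
  refine ⟨(φ.memLp 2 volume).integrable_mul h, ?_⟩
  rw [Lp.toTemperedDistribution_apply]
  refine integral_congr_ae ?_
  filter_upwards [h.coeFn_toLp] with x hx
  rw [hx, smul_eq_mul]

theorem coe_Lp_injective {f g : L2 n}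
    (h : (f : 𝓢'(Eucl n, ℂ)) = (g : 𝓢'(Eucl n, ℂ))) : f = g := by
  have := LinearMap.ker_eq_bot.1
    (Lp.ker_toTemperedDistributionCLM_eq_bot (E := Eucl n) (F := ℂ) (μ := volume) (p := 2))
  exact this h

/-- Inverting `⟨D⟩ˢ U = g` shows that `U` is the `L²` function `⟨D⟩^{-s} g`. It agrees a.e. with `u`
because both have the same pairings with test functions. -/
theorem hasBessel_iff {s : ℝ} (hs : 0 ≤ s) {u : Eucl n → ℝ}
    {g : L2 n} :
    HasBessel s 2 u g ↔ ∃ h : MemLp (fun x => (u x : ℂ)) 2 volume,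
      (𝓕 (h.toLp _) : L2 n) =ᵐ[volume] fun ξ => (((1 + ‖ξ‖ ^ 2) ^ (-s / 2) : ℝ) : ℂ) * (𝓕 g : L2 n) ξ := by
  obtain ⟨f, hf, hf'⟩ := besselPotential_neg_coe hs g
  constructor
  · rintro ⟨U, hU, hUg⟩
    rw [← besselPotential_neg_apply_eq_iff, hf] at hUg
    subst hUg
    have h1 := hU.ae_eq
    have h2 : MemLp (fun x => (u x : ℂ)) 2 volume := (memLp_congr_ae h1).2 (Lp.memLp f)
    have h3 : h2.toLp _ = f := Lp.ext (h2.coeFn_toLp.trans h1)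
    exact ⟨h2, by rw [h3]; exact hf'⟩
  · rintro ⟨h, h'⟩
    refine ⟨_, represents_toLp h, ?_⟩
    rw [← besselPotential_neg_apply_eq_iff, hf]
    have : (𝓕 f : L2 n) = 𝓕 (h.toLp _) := Lp.ext (hf'.trans h'.symm)
    have h2 : f = h.toLp _ := by
      rw [← fourierInv_fourier_eq (F := L2 n) f, this, fourierInv_fourier_eq]
    rw [h2]

/-- The squared Sobolev norm `∫ (1+|ξ|²)ˢ |𝓕 f|² dξ` of an `L²` function. -/
def sobolevEnergy (s : ℝ) (f : L2 n) : ℝ≥0∞ :=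
  ∫⁻ ξ, ENNReal.ofReal ((1 + ‖ξ‖ ^ 2) ^ s) * ‖(𝓕 f : L2 n) ξ‖ₑ ^ 2

theorem Lp_enorm_sq {α F : Type*} [MeasurableSpace α] {μ : Measure α} [NormedAddCommGroup F]
    (g : Lp F 2 μ) : ‖g‖ₑ ^ 2 = ∫⁻ x, ‖g x‖ₑ ^ 2 ∂μ := by
  rw [Lp.enorm_def, eLpNorm_eq_lintegral_rpow_enorm_toReal (by norm_num) (by norm_num)]
  rw [← ENNReal.rpow_natCast, ← ENNReal.rpow_mul]
  norm_num

theorem eLpNorm_two_sq {α F : Type*} [MeasurableSpace α] {μ : Measure α} [NormedAddCommGroup F]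
    (g : α → F) : eLpNorm g 2 μ ^ 2 = ∫⁻ x, ‖g x‖ₑ ^ 2 ∂μ := by
  rw [eLpNorm_eq_lintegral_rpow_enorm_toReal (by norm_num) (by norm_num)]
  rw [← ENNReal.rpow_natCast, ← ENNReal.rpow_mul]
  norm_num

theorem HasBessel.enorm_sq {s : ℝ} (hs : 0 ≤ s) {u : Eucl n → ℝ}
    {g : L2 n} (hg : HasBessel s 2 u g) :
    ∃ h : MemLp (fun x => (u x : ℂ)) 2 volume, sobolevEnergy s (h.toLp _) = ‖g‖ₑ ^ 2 := by
  obtain ⟨h, h'⟩ := (hasBessel_iff hs).1 hg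
  refine ⟨h, ?_⟩
  have h2 : ‖(𝓕 g : L2 n)‖ₑ = ‖g‖ₑ := by rw [← ofReal_norm, ← ofReal_norm, Lp.norm_fourier_eq]
  rw [← h2, Lp_enorm_sq, sobolevEnergy]
  refine lintegral_congr_ae ?_
  filter_upwards [h'] with ξ hξ
  rw [hξ, enorm_mul, mul_pow, ← mul_assoc, ← ofReal_norm (((_ : ℝ) : ℂ)), Complex.norm_real,
    Real.norm_eq_abs, abs_of_nonneg (by positivity), ← ENNReal.ofReal_pow (by positivity),
    ← ENNReal.ofReal_mul (by positivity), ← Real.rpow_mul_natCast (by positivity),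
    ← Real.rpow_add (by positivity)]
  norm_num

theorem exists_hasBessel {s : ℝ} (hs : 0 ≤ s) {u : Eucl n → ℝ}
    (h : MemLp (fun x => (u x : ℂ)) 2 volume) (hfin : sobolevEnergy s (h.toLp _) < ⊤) :
    ∃ g, HasBessel s 2 u g := by
  have hm : Continuous fun ξ : Eucl n => (((1 + ‖ξ‖ ^ 2) ^ (s / 2) : ℝ) : ℂ) := by
    refine Complex.continuous_ofReal.comp (Continuous.rpow_const (by fun_prop) fun ξ => ?_)
    left; positivity
  have hG : MemLp (fun ξ => (((1 + ‖ξ‖ ^ 2) ^ (s / 2) : ℝ) : ℂ) * (𝓕 (h.toLp _) : L2 n) ξ) 2 volume := by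
    refine ⟨hm.aestronglyMeasurable.mul (Lp.aestronglyMeasurable _), ?_⟩
    refine (ENNReal.pow_lt_top_iff.1 (?_ : _ ^ 2 < ⊤)).resolve_right two_ne_zero
    rw [eLpNorm_two_sq]
    refine lt_of_eq_of_lt (lintegral_congr fun ξ => ?_) hfin
    rw [enorm_mul, mul_pow, ← ofReal_norm (((_ : ℝ) : ℂ)), Complex.norm_real,
      Real.norm_eq_abs, abs_of_nonneg (by positivity), ← ENNReal.ofReal_pow (by positivity),
      ← Real.rpow_mul_natCast (by positivity)]
    norm_num
  refine ⟨𝓕⁻ (hG.toLp _), (hasBessel_iff hs).2 ⟨h, ?_⟩⟩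
  rw [fourier_fourierInv_eq]
  filter_upwards [hG.coeFn_toLp] with ξ hξ
  rw [hξ, ← mul_assoc, ← Complex.ofReal_mul, ← Real.rpow_add (by positivity)]
  ring_nf
  simp

theorem memHs_iff_sobolevEnergy {s : ℝ} (hs : 0 ≤ s) {u : Eucl n → ℝ} :
    MemHs s u ↔ ∃ h : MemLp (fun x => (u x : ℂ)) 2 volume, sobolevEnergy s (h.toLp _) < ⊤ := by
  constructor
  · rintro ⟨_, U, hU, g, hg⟩
    obtain ⟨h, h'⟩ := HasBessel.enorm_sq hs ⟨U, hU, hg⟩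
    exact ⟨h, by rw [h']; exact ENNReal.pow_lt_top enorm_lt_top⟩
  · rintro ⟨h, h'⟩
    obtain ⟨g, U, hU, hg⟩ := exists_hasBessel hs h h'
    exact ⟨inferInstance, U, hU, g, hg⟩

theorem hsNorm_sq_le {s : ℝ} (hs : 0 ≤ s) {u : Eucl n → ℝ}
    (h : MemLp (fun x => (u x : ℂ)) 2 volume) :
    hsNorm s u ^ 2 ≤ sobolevEnergy s (h.toLp _) := by
  rcases (le_top : sobolevEnergy s (h.toLp _) ≤ ⊤).eq_or_lt with h1 | h1
  · rw [h1]; exact le_top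
  obtain ⟨g, hg⟩ := exists_hasBessel hs h h1
  obtain ⟨h2, h3⟩ := hg.enorm_sq hs
  rw [h3]
  gcongr
  exact iInf₂_le g hg

theorem exists_sobolevEnergy_lt {s : ℝ} (hs : 0 ≤ s) {u : Eucl n → ℝ} {ε : ℝ≥0∞}
    (hu : hsNorm s u < ε) :
    ∃ h : MemLp (fun x => (u x : ℂ)) 2 volume, sobolevEnergy s (h.toLp _) < ε ^ 2 := by
  obtain ⟨g, hg⟩ := iInf_lt_iff.1 hu
  obtain ⟨hg, hlt⟩ := iInf_lt_iff.1 hg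
  obtain ⟨h, h'⟩ := hg.enorm_sq hs
  refine ⟨h, ?_⟩
  rw [h']
  exact ENNReal.pow_lt_pow_left two_ne_zero hlt

end FracCalderon

end

noncomputable section

namespace FracCalderon

variable {n : ℕ}

open FourierTransform TemperedDistribution
open scoped RealInnerProductSpace

/-! ### Translations and the symbol of the Gagliardo seminorm -/

/-- The phase `e^{2πi⟨h,ξ⟩}`. -/
def phase (h ξ : Eucl n) : ℂ := (Real.fourierChar ⟪h, ξ⟫ : ℂ)

theorem phase_eq_exp (h ξ : Eucl n) :
    phase h ξ = Complex.exp (Complex.I * ((2 * Real.pi * ⟪h, ξ⟫ : ℝ) : ℂ)) := by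
  rw [phase, Real.fourierChar_apply, mul_comm]

theorem continuous_phase : Continuous fun p : Eucl n × Eucl n => phase p.1 p.2 := by
  simp only [phase_eq_exp]
  fun_prop

theorem norm_phase_sub_one_le (h ξ : Eucl n) : ‖phase h ξ - 1‖ ≤ 2 * Real.pi * (‖h‖ * ‖ξ‖) := by
  rw [phase_eq_exp]
  refine (Real.norm_exp_I_mul_ofReal_sub_one_le).trans ?_
  rw [Real.norm_eq_abs, abs_mul, abs_of_pos (by positivity : (0:ℝ) < 2 * Real.pi)]
  gcongr
  exact abs_real_inner_le_norm h ξ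

theorem norm_phase (h ξ : Eucl n) : ‖phase h ξ‖ = 1 := Circle.norm_coe _

/-- By duality: the translation moves to the test function, and the inverse Fourier transform of a
translate of `𝓕 ψ` is `ψ` times a phase. -/
theorem fourier_translate {f g : L2 n} {h : Eucl n} (hg : g =ᵐ[volume] fun x => f (x + h)) :
    (𝓕 g : L2 n) =ᵐ[volume] fun ξ => phase h ξ * (𝓕 f : L2 n) ξ := by
  have hm : MemLp (fun ξ => phase h ξ * (𝓕 f : L2 n) ξ) 2 volume := by
    refine (Lp.memLp (𝓕 f : L2 n)).of_le ?_ (ae_of_all _ fun ξ => ?_)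
    · exact (continuous_phase.comp (by fun_prop : Continuous fun ξ : Eucl n => (h, ξ))
        ).aestronglyMeasurable.mul (Lp.aestronglyMeasurable _)
    · rw [norm_mul, norm_phase, one_mul]
  suffices hs : (𝓕 g : L2 n) = hm.toLp _ by rw [hs]; exact hm.coeFn_toLp
  apply coe_Lp_injective
  ext ψ
  rw [← Lp.fourier_toTemperedDistribution_eq, TemperedDistribution.fourier_apply,
    Lp.toTemperedDistribution_apply, Lp.toTemperedDistribution_apply]
  have hid : (fun x : Eucl n => x + (-h)).HasTemperateGrowth := by fun_prop
  have hal : AntilipschitzWith 1 (fun x : Eucl n => x + (-h)) :=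
    (isometry_add_right (-h)).antilipschitz
  set θ : 𝓢(Eucl n, ℂ) := SchwartzMap.compCLMOfAntilipschitz ℂ hid hal (𝓕 ψ) with hθ
  have hθ' : ∀ x, θ x = (𝓕 ψ) (x + -h) := fun x => rfl
  have h1 : ∫ x, (𝓕 ψ) x • g x = ∫ x, θ x • f x := by
    rw [← integral_add_right_eq_self (fun x => θ x • f x) h]
    refine integral_congr_ae ?_
    filter_upwards [hg] with x hx
    simp only [hx, hθ', add_neg_cancel_right]
  have h2 : ∫ x, θ x • f x = (f : 𝓢'(Eucl n, ℂ)) (𝓕 (𝓕⁻ θ)) := by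
    rw [fourier_fourierInv_eq, Lp.toTemperedDistribution_apply]
  rw [h1, h2, ← TemperedDistribution.fourier_apply, Lp.fourier_toTemperedDistribution_eq,
    Lp.toTemperedDistribution_apply]
  have h3 : ∀ ξ, (𝓕⁻ θ) ξ = phase h ξ * ψ ξ := by
    intro ξ
    have h4 : (𝓕⁻ θ) ξ = (𝓕 ((⇑(𝓕 ψ : 𝓢(Eucl n, ℂ))) ∘ fun x => x + -h)) (-ξ) := by
      rw [SchwartzMap.fourierInv_coe, Real.fourierInv_eq_fourier_neg]
      rfl
    rw [h4]
    have h5 := congrFun (VectorFourier.fourierIntegral_comp_add_right Real.fourierChar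
      (volume : Measure (Eucl n)) (innerₗ (Eucl n)) (⇑(𝓕 ψ : 𝓢(Eucl n, ℂ))) (-h)) (-ξ)
    refine h5.trans ?_
    have h6 : VectorFourier.fourierIntegral Real.fourierChar (volume : Measure (Eucl n))
      (innerₗ (Eucl n)) (⇑(𝓕 ψ : 𝓢(Eucl n, ℂ))) (-ξ) = ψ ξ := by
      change 𝓕 (⇑(𝓕 ψ : 𝓢(Eucl n, ℂ))) (-ξ) = ψ ξ
      rw [← Real.fourierInv_eq_fourier_neg, ← SchwartzMap.fourierInv_coe,
        fourierInv_fourier_eq]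
    rw [h6, Circle.smul_def, smul_eq_mul, phase]
    simp [innerₗ_apply_apply]
  refine integral_congr_ae ?_
  filter_upwards [hm.coeFn_toLp] with ξ hξ
  rw [hξ, h3, smul_eq_mul, smul_eq_mul]
  ring

theorem lintegral_translate_sub (f : L2 n) (h : Eucl n) :
    ∫⁻ x, ‖f (x + h) - f x‖ₑ ^ 2 = ∫⁻ ξ, ‖phase h ξ - 1‖ₑ ^ 2 * ‖(𝓕 f : L2 n) ξ‖ₑ ^ 2 := by
  have hτ := measurePreserving_add_right (volume : Measure (Eucl n)) h
  set g : L2 n := Lp.compMeasurePreserving _ hτ f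
  have hg : g =ᵐ[volume] fun x => f (x + h) := Lp.coeFn_compMeasurePreserving f hτ
  have h1 : ‖g - f‖ₑ ^ 2 = ‖(𝓕 (g - f) : L2 n)‖ₑ ^ 2 := by
    rw [← ofReal_norm, ← ofReal_norm, Lp.norm_fourier_eq]
  rw [Lp_enorm_sq, Lp_enorm_sq] at h1
  refine Eq.trans (lintegral_congr_ae ?_) (h1.trans (lintegral_congr_ae ?_))
  · filter_upwards [hg, Lp.coeFn_sub g f] with x h2 h3
    rw [h3, Pi.sub_apply, h2]
  · have : (𝓕 (g - f) : L2 n) = 𝓕 g - 𝓕 f := map_sub (Lp.fourierTransformₗᵢ (Eucl n) ℂ) g f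
    rw [this]
    filter_upwards [fourier_translate hg, Lp.coeFn_sub (𝓕 g : L2 n) (𝓕 f)] with ξ h2 h3
    rw [h3, Pi.sub_apply, h2, ← mul_pow, ← enorm_mul, sub_mul, one_mul]

/-! ### The singular kernel -/

/-- The kernel `|h|^{-(n+2s)}`. -/
def kern (s : ℝ) (h : Eucl n) : ℝ≥0∞ := ENNReal.ofReal (‖h‖ ^ (-((n : ℝ) + 2 * s)))

theorem measurable_kern (s : ℝ) : Measurable (kern s : Eucl n → ℝ≥0∞) := by
  unfold kern; fun_prop

theorem lintegral_kern_far_lt_top {s : ℝ} (hs : 0 < s) {ρ : ℝ} (hρ : 0 < ρ) :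
    ∫⁻ h in {h : Eucl n | ρ ≤ ‖h‖}, kern s h < ⊤ := by
  have hms : MeasurableSet {h : Eucl n | ρ ≤ ‖h‖} := measurableSet_le measurable_const
    measurable_norm
  -- If `ρ ≤ |h|`, then `|h| ≥ ρ/(1+ρ) · (1+|h|)`, which reduces the claim to the integrability of
  -- `(1+|h|)^{-(n+2s)}`.
  have h1 : ∫⁻ h : Eucl n, ENNReal.ofReal ((ρ / (1 + ρ)) ^ (-((n : ℝ) + 2 * s))) *
      ENNReal.ofReal ((1 + ‖h‖) ^ (-((n : ℝ) + 2 * s))) < ⊤ := by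
    rw [lintegral_const_mul' _ _ ENNReal.ofReal_ne_top]
    exact ENNReal.mul_lt_top ENNReal.ofReal_lt_top
      (finite_integral_one_add_norm (by rw [finrank_euclideanSpace_fin]; linarith))
  refine lt_of_le_of_lt ?_ h1
  refine (setLIntegral_mono' hms fun h hh => ?_).trans (setLIntegral_le_lintegral _ _)
  have hh : ρ ≤ ‖h‖ := hh
  rw [kern, ← ENNReal.ofReal_mul (by positivity), ← Real.mul_rpow (by positivity) (by positivity)]
  refine ENNReal.ofReal_le_ofReal (Real.rpow_le_rpow_of_nonpos (by positivity) ?_ ?_)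
  · rw [div_mul_eq_mul_div, div_le_iff₀ (by positivity)]
    nlinarith
  · have : (0:ℝ) ≤ n := n.cast_nonneg
    linarith

/-- The integrand is `|h|^{2-n-2s}`, integrable at the origin because `s < 1`. -/
theorem lintegral_kern_near_lt_top (hn : 1 ≤ n) {s : ℝ} (hs : s < 1) :
    ∫⁻ h in Metric.ball (0 : Eucl n) 1, kern s h * ENNReal.ofReal (‖h‖ ^ 2) < ⊤ := by
  have h1 : IntegrableOn (fun h : Eucl n => ‖h‖ ^ (-((n : ℝ) + 2 * s)) * ‖h‖ ^ 2)
      (Metric.ball 0 1) volume := by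
    refine integrableOn_ball_of_norm_le_rpow (C := 1) (α := (n : ℝ) + 2 * s - 2)
      (by simpa using hn) (by simp; linarith) ?_ ?_
    · have : ∀ᵐ h : Eucl n ∂volume, h ≠ 0 := by
        have : Nontrivial (Eucl n) := Module.nontrivial_of_finrank_pos (R := ℝ) (by simp; omega)
        exact Measure.ae_ne volume 0
      refine ae_restrict_of_ae (this.mono fun h hh => ?_)
      have hp : 0 < ‖h‖ := norm_pos_iff.2 hh
      rw [Real.norm_of_nonneg (by positivity), one_mul, ← Real.rpow_natCast, ← Real.rpow_add hp]
      apply le_of_eq; congr 1; push_cast; ring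
    · exact Measurable.aestronglyMeasurable (by fun_prop)
  refine lt_of_eq_of_lt (lintegral_congr fun h => ?_) h1.lintegral_lt_top
  rw [kern, ENNReal.ofReal_mul (by positivity)]

/-- The symbol `∫ |h|^{-(n+2s)} |e^{2πi⟨h,ξ⟩} - 1|² dh`. -/
def symb (s : ℝ) (ξ : Eucl n) : ℝ≥0∞ := ∫⁻ h, kern s h * ‖phase h ξ - 1‖ₑ ^ 2

/-- Near the origin `|e^{2πi⟨h,ξ⟩} - 1|²` is `O(|h|²)`, which compensates the singularity; elsewhere
it is at most 4 and the kernel is integrable. -/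
theorem symb_lt_top (hn : 1 ≤ n) {s : ℝ} (hs0 : 0 < s) (hs : s < 1) (ξ : Eucl n) :
    symb s ξ < ⊤ := by
  rw [symb, ← lintegral_add_compl _ (measurableSet_ball (x := (0 : Eucl n)) (ε := 1))]
  refine ENNReal.add_lt_top.2 ⟨?_, ?_⟩
  · have h1 : ∫⁻ h in Metric.ball (0 : Eucl n) 1, ENNReal.ofReal ((2 * Real.pi * ‖ξ‖) ^ 2) *
        (kern s h * ENNReal.ofReal (‖h‖ ^ 2)) < ⊤ := by
      rw [lintegral_const_mul' _ _ ENNReal.ofReal_ne_top]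
      exact ENNReal.mul_lt_top ENNReal.ofReal_lt_top (lintegral_kern_near_lt_top hn hs)
    refine lt_of_le_of_lt (lintegral_mono fun h => ?_) h1
    rw [mul_left_comm, ← ENNReal.ofReal_mul (by positivity)]
    gcongr
    rw [← ofReal_norm, ← ENNReal.ofReal_pow (by positivity), ← mul_pow]
    refine ENNReal.ofReal_le_ofReal (pow_le_pow_left₀ (norm_nonneg _) ?_ 2)
    refine (norm_phase_sub_one_le h ξ).trans (le_of_eq (by ring))
  · have h2 : (Metric.ball (0 : Eucl n) 1)ᶜ = {h : Eucl n | 1 ≤ ‖h‖} := by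
      ext h; simp
    rw [h2]
    have h1 : ∫⁻ h in {h : Eucl n | 1 ≤ ‖h‖}, ENNReal.ofReal (2 ^ 2) * kern s h < ⊤ := by
      rw [lintegral_const_mul' _ _ ENNReal.ofReal_ne_top]
      exact ENNReal.mul_lt_top ENNReal.ofReal_lt_top (lintegral_kern_far_lt_top hs0 one_pos)
    refine lt_of_le_of_lt (lintegral_mono fun h => ?_) h1
    rw [mul_comm]
    gcongr
    rw [← ofReal_norm, ← ENNReal.ofReal_pow (by positivity)]
    refine ENNReal.ofReal_le_ofReal (pow_le_pow_left₀ (norm_nonneg _) ?_ 2)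
    refine (norm_sub_le _ _).trans ?_
    rw [norm_phase]; norm_num

theorem symb_pos {s : ℝ} {ξ : Eucl n} (hξ : ξ ≠ 0) : 0 < symb s ξ := by
  rw [pos_iff_ne_zero, symb, Ne, lintegral_eq_zero_iff']
  · intro h0
    have hc : Continuous fun h : Eucl n => phase h ξ :=
      continuous_phase.comp (by fun_prop : Continuous fun h : Eucl n => (h, ξ))
    have hop : IsOpen ({h : Eucl n | h ≠ 0} ∩ {h | phase h ξ ≠ 1}) :=
      (isOpen_ne_fun continuous_id continuous_const).inter (isOpen_ne_fun hc continuous_const)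
    have hne : ({h : Eucl n | h ≠ 0} ∩ {h | phase h ξ ≠ 1}).Nonempty := by
      -- This vector has inner product `1/2` with `ξ`, so its phase is `-1`.
      refine ⟨(1 / (2 * ‖ξ‖ ^ 2)) • ξ, ?_, ?_⟩
      · have : ‖ξ‖ ≠ 0 := norm_ne_zero_iff.2 hξ
        simp [hξ]
      · have : ‖ξ‖ ≠ 0 := norm_ne_zero_iff.2 hξ
        have h2 : 2 * Real.pi * ⟪(1 / (2 * ‖ξ‖ ^ 2)) • ξ, ξ⟫ = Real.pi := by
          rw [real_inner_smul_left, real_inner_self_eq_norm_sq]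
          field_simp
        rw [Set.mem_ofPred_eq, phase_eq_exp, h2, mul_comm, Complex.exp_pi_mul_I]
        norm_num
    refine (hop.measure_pos volume hne).ne' (measure_mono_null ?_ (ae_iff.1 h0))
    rintro h ⟨h1, h2⟩
    have h1' : 0 < ‖h‖ := norm_pos_iff.2 h1
    have h3 : kern s h ≠ 0 := by
      rw [kern]
      exact (ENNReal.ofReal_pos.2 (by positivity)).ne'
    have h4 : phase h ξ - 1 ≠ 0 := sub_ne_zero.2 h2
    simp [h3, h4]
  · refine ((measurable_kern s).mul ?_).aemeasurable
    have hc : Continuous fun h : Eucl n => phase h ξ - 1 :=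
      (continuous_phase.comp (by fun_prop : Continuous fun h : Eucl n => (h, ξ))).sub
        continuous_const
    exact (hc.enorm.measurable.pow_const 2)

theorem lintegral_comp_smul_pos (f : Eucl n → ℝ≥0∞) {t : ℝ} (ht : 0 < t) :
    ∫⁻ x, f (t • x) = ENNReal.ofReal ((t ^ n)⁻¹) * ∫⁻ x, f x := by
  have h := Measure.map_addHaar_smul (volume : Measure (Eucl n)) ht.ne'
  have h1 : ∫⁻ x, f (t • x) = ∫⁻ x, f x ∂(Measure.map (t • ·) (volume : Measure (Eucl n))) :=
    ((Homeomorph.smulOfNeZero t ht.ne').measurableEmbedding.lintegral_map f).symm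
  rw [h1, h, lintegral_smul_measure, finrank_euclideanSpace_fin, abs_of_pos (by positivity),
    smul_eq_mul]

theorem kern_smul (s : ℝ) {t : ℝ} (ht : 0 < t) (h : Eucl n) :
    kern s (t • h) = ENNReal.ofReal (t ^ (-((n : ℝ) + 2 * s))) * kern s h := by
  rw [kern, kern, norm_smul, Real.norm_of_nonneg ht.le, Real.mul_rpow ht.le (norm_nonneg _),
    ENNReal.ofReal_mul (by positivity)]

theorem symb_smul (s : ℝ) {t : ℝ} (ht : 0 < t) (ξ : Eucl n) :
    symb s (t • ξ) = ENNReal.ofReal (t ^ (2 * s)) * symb s ξ := by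
  have h1 := lintegral_comp_smul_pos (fun h => kern s h * ‖phase h ξ - 1‖ₑ ^ 2) ht
  have h2 : ∀ h, phase (t • h) ξ = phase h (t • ξ) := by
    intro h; rw [phase, phase, real_inner_smul_left, real_inner_smul_right]
  simp only [kern_smul s ht, h2, mul_assoc] at h1
  rw [lintegral_const_mul' _ _ ENNReal.ofReal_ne_top] at h1
  have h3 : symb s (t • ξ) = ENNReal.ofReal (t ^ ((n : ℝ) + 2 * s)) *
      (ENNReal.ofReal (t ^ (-((n : ℝ) + 2 * s))) * symb s (t • ξ)) := by
    rw [← mul_assoc, ← ENNReal.ofReal_mul (by positivity), ← Real.rpow_add ht]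
    simp
  rw [h3, symb, h1, ← symb, ← mul_assoc, ← ENNReal.ofReal_mul (by positivity)]
  congr 2
  rw [← Real.rpow_natCast, ← Real.rpow_neg ht.le, ← Real.rpow_add ht]
  congr 1; ring

/-- The reflection that maps `ξ` to `η` preserves Lebesgue measure, inner products and the radial
kernel. -/
theorem symb_eq_of_norm_eq (s : ℝ) {ξ η : Eucl n} (h : ‖ξ‖ = ‖η‖) : symb s ξ = symb s η := by
  set R := (ℝ ∙ (ξ - η))ᗮ.reflection
  have hR : R ξ = η := Submodule.reflection_sub h
  have hmp : MeasurePreserving R volume volume := R.measurePreserving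
  rw [symb, symb, ← hmp.lintegral_comp_emb R.toHomeomorph.measurableEmbedding
    (fun h => kern s h * ‖phase h η - 1‖ₑ ^ 2)]
  refine lintegral_congr fun x => ?_
  have h2 : phase (R x) η = phase x ξ := by
    rw [phase, phase, ← hR, R.inner_map_map]
  rw [h2, kern, kern, R.norm_map]

theorem symb_zero (s : ℝ) : symb s (0 : Eucl n) = 0 := by
  simp [symb, phase]

/-- Homogeneity and rotation invariance of the symbol. -/
theorem exists_symb_eq (hn : 1 ≤ n) {s : ℝ} (hs0 : 0 < s) (hs : s < 1) :
    ∃ c : ℝ≥0∞, c ≠ 0 ∧ c ≠ ⊤ ∧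
      ∀ ξ : Eucl n, symb s ξ = ENNReal.ofReal (‖ξ‖ ^ (2 * s)) * c := by
  have : Nontrivial (Eucl n) := Module.nontrivial_of_finrank_pos (R := ℝ) (by simp; omega)
  obtain ⟨e, he⟩ := exists_norm_eq (Eucl n) zero_le_one
  have he0 : e ≠ 0 := by rintro rfl; simp at he
  refine ⟨symb s e, (symb_pos he0).ne', (symb_lt_top hn hs0 hs e).ne, fun ξ => ?_⟩
  rcases eq_or_ne ξ 0 with rfl | hξ
  · rw [symb_zero, norm_zero, Real.zero_rpow (by positivity)]; simp
  · rw [← symb_smul s (norm_pos_iff.2 hξ)]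
    exact symb_eq_of_norm_eq s (by rw [norm_smul, he]; simp)

end FracCalderon

end

noncomputable section

namespace FracCalderon

variable {n : ℕ}

open FourierTransform
open scoped RealInnerProductSpace

/-! ### The Gagliardo seminorm -/

/-- The increment `(x, y) ↦ u(x) - u(y)`. -/
def increment (u : Eucl n → ℝ) (z : Eucl n × Eucl n) : ℝ := u z.1 - u z.2

/-- The measure `|x-y|^{-(n+2s)} dx dy` on `ℝ²ⁿ`. -/
def gagMeasure (n : ℕ) (s : ℝ) : Measure (Eucl n × Eucl n) :=
  volume.withDensity fun z => kern s (z.1 - z.2)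

/-- The square of the Gagliardo seminorm. -/
def gag (s : ℝ) (u : Eucl n → ℝ) : ℝ≥0∞ := ∫⁻ z, ‖increment u z‖ₑ ^ 2 ∂(gagMeasure n s)

theorem measurable_kern_sub (s : ℝ) :
    Measurable fun z : Eucl n × Eucl n => kern s (z.1 - z.2) :=
  (measurable_kern s).comp (measurable_fst.sub measurable_snd)

theorem gagMeasure_absolutelyContinuous (s : ℝ) :
    gagMeasure n s ≪ (volume : Measure (Eucl n × Eucl n)) :=
  withDensity_absolutelyContinuous _ _

theorem ae_fst {p : Eucl n → Prop} (h : ∀ᵐ x, p x) : ∀ᵐ z : Eucl n × Eucl n, p z.1 :=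
  Measure.quasiMeasurePreserving_fst.ae h

theorem ae_snd {p : Eucl n → Prop} (h : ∀ᵐ x, p x) : ∀ᵐ z : Eucl n × Eucl n, p z.2 :=
  Measure.quasiMeasurePreserving_snd.ae h

theorem increment_ae_eq {u v : Eucl n → ℝ} (h : u =ᵐ[volume] v) :
    increment u =ᵐ[volume] increment v := by
  filter_upwards [ae_fst h, ae_snd h] with z h1 h2
  simp only [increment, h1, h2]

theorem increment_ae_eq_gag (s : ℝ) {u v : Eucl n → ℝ} (h : u =ᵐ[volume] v) :
    increment u =ᵐ[gagMeasure n s] increment v :=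
  (gagMeasure_absolutelyContinuous s).ae_eq (increment_ae_eq h)

theorem measurable_increment {u : Eucl n → ℝ} (hu : Measurable u) : Measurable (increment u) :=
  (hu.comp measurable_fst).sub (hu.comp measurable_snd)

theorem aestronglyMeasurable_increment {u : Eucl n → ℝ} (hu : AEStronglyMeasurable u volume) :
    AEStronglyMeasurable (increment u) (volume : Measure (Eucl n × Eucl n)) :=
  ⟨increment (hu.mk u), (measurable_increment hu.measurable_mk).stronglyMeasurable,
    increment_ae_eq hu.ae_eq_mk⟩

theorem lintegral_prod_eq_shear {F : Eucl n × Eucl n → ℝ≥0∞} (hF : Measurable F) :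
    ∫⁻ z, F z = ∫⁻ h, ∫⁻ x, F (x + h, x) := by
  rw [Measure.volume_eq_prod, lintegral_prod_symm' _ hF]
  have h1 : ∀ y : Eucl n, ∫⁻ x, F (x, y) = ∫⁻ h, F (y + h, y) := fun y =>
    (lintegral_add_left_eq_self (fun x => F (x, y)) y).symm
  simp only [h1]
  rw [lintegral_lintegral_swap]
  exact (hF.comp ((measurable_fst.add measurable_snd).prodMk measurable_fst)).aemeasurable

/-- The substitution `x = y + h` turns the double integral into `L²` norms of differences of
translates. Restricting `h` to `A` allows distant pairs to be treated separately. -/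
theorem setLIntegral_gagMeasure_eq_shear (s : ℝ) {A : Set (Eucl n)} (hA : MeasurableSet A)
    {u : Eucl n → ℝ} (hu : AEStronglyMeasurable u volume) :
    ∫⁻ z in {z | z.1 - z.2 ∈ A}, ‖increment u z‖ₑ ^ 2 ∂(gagMeasure n s) =
      ∫⁻ h in A, kern s h * ∫⁻ x, ‖u (x + h) - u x‖ₑ ^ 2 := by
  have hS : MeasurableSet {z : Eucl n × Eucl n | z.1 - z.2 ∈ A} :=
    (measurable_fst.sub measurable_snd) hA
  set v := hu.mk u with hv
  have hvm : Measurable v := hu.measurable_mk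
  have huv : u =ᵐ[volume] v := hu.ae_eq_mk
  have h1 : ∀ h, ∫⁻ x, ‖u (x + h) - u x‖ₑ ^ 2 = ∫⁻ x, ‖v (x + h) - v x‖ₑ ^ 2 := by
    intro h
    refine lintegral_congr_ae ?_
    filter_upwards [huv, (measurePreserving_add_right (volume : Measure (Eucl n))
      h).quasiMeasurePreserving.ae huv] with x h1 h2
    rw [h1, h2]
  simp only [h1]
  have h2 : ∫⁻ z in {z | z.1 - z.2 ∈ A}, ‖increment u z‖ₑ ^ 2 ∂(gagMeasure n s) =
      ∫⁻ z in {z | z.1 - z.2 ∈ A}, ‖increment v z‖ₑ ^ 2 ∂(gagMeasure n s) := by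
    refine lintegral_congr_ae (ae_restrict_of_ae ?_)
    filter_upwards [increment_ae_eq_gag s huv] with z hz
    rw [hz]
  have hm2 : Measurable fun z => ‖increment v z‖ₑ ^ 2 :=
    (measurable_increment hvm).enorm.pow_const 2
  have hprod : Measurable ((fun z : Eucl n × Eucl n => kern s (z.1 - z.2)) *
      fun z => ‖increment v z‖ₑ ^ 2) := (measurable_kern_sub s).mul hm2
  rw [h2, gagMeasure, setLIntegral_withDensity_eq_setLIntegral_mul _ (measurable_kern_sub s)
    hm2 hS, ← lintegral_indicator hS, lintegral_prod_eq_shear (hprod.indicator hS),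
    ← lintegral_indicator hA]
  refine lintegral_congr fun h => ?_
  by_cases hh : h ∈ A
  · rw [Set.indicator_of_mem hh, ← lintegral_const_mul _ (by fun_prop)]
    refine lintegral_congr fun x => ?_
    rw [Set.indicator_of_mem (by simpa using hh)]
    simp [increment]
  · rw [Set.indicator_of_notMem hh]
    refine (lintegral_congr fun x => ?_).trans lintegral_zero
    rw [Set.indicator_of_notMem (by simpa using hh)]

theorem gag_eq_shear (s : ℝ) {u : Eucl n → ℝ} (hu : AEStronglyMeasurable u volume) :
    gag s u = ∫⁻ h, kern s h * ∫⁻ x, ‖u (x + h) - u x‖ₑ ^ 2 := by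
  simpa [gag] using setLIntegral_gagMeasure_eq_shear s MeasurableSet.univ hu

theorem measurable_phase_sub_one :
    Measurable fun p : Eucl n × Eucl n => ‖phase p.1 p.2 - 1‖ₑ ^ 2 :=
  ((continuous_phase.sub continuous_const).enorm.measurable.pow_const 2)

theorem lintegral_kern_mul_phase (s : ℝ) {F : Eucl n → ℝ≥0∞} (hF : Measurable F) :
    ∫⁻ y, kern s y * ∫⁻ ξ, ‖phase y ξ - 1‖ₑ ^ 2 * F ξ = ∫⁻ ξ, symb s ξ * F ξ := by
  have h2 : ∀ y, kern s y * ∫⁻ ξ, ‖phase y ξ - 1‖ₑ ^ 2 * F ξ =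
      ∫⁻ ξ, kern s y * ‖phase y ξ - 1‖ₑ ^ 2 * F ξ := by
    intro y
    have hp : Measurable fun ξ : Eucl n => ‖phase y ξ - 1‖ₑ ^ 2 :=
      ((continuous_phase.uncurry_left y).sub continuous_const).enorm.measurable.pow_const 2
    have hpF : Measurable fun ξ => ‖phase y ξ - 1‖ₑ ^ 2 * F ξ := hp.mul hF
    rw [← lintegral_const_mul _ hpF]
    simp only [mul_assoc]
  simp only [h2]
  rw [lintegral_lintegral_swap]
  · refine lintegral_congr fun ξ => ?_
    have hp : Measurable fun y : Eucl n => ‖phase y ξ - 1‖ₑ ^ 2 :=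
      ((continuous_phase.uncurry_right ξ).sub continuous_const).enorm.measurable.pow_const 2
    have hkp : Measurable fun y => kern s y * ‖phase y ξ - 1‖ₑ ^ 2 := (measurable_kern s).mul hp
    rw [lintegral_mul_const _ hkp, symb]
  · have hk : Measurable fun p : Eucl n × Eucl n => kern s p.1 :=
      (measurable_kern s).comp measurable_fst
    have hF2 : Measurable fun p : Eucl n × Eucl n => F p.2 := hF.comp measurable_snd
    exact ((hk.mul measurable_phase_sub_one).mul hF2).aemeasurable

/-- Plancherel's formula for the Gagliardo seminorm. -/
theorem gag_eq_lintegral_symb (s : ℝ) {u : Eucl n → ℝ}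
    (h : MemLp (fun x => (u x : ℂ)) 2 volume) :
    gag s u = ∫⁻ ξ, symb s ξ * ‖(𝓕 (h.toLp _) : L2 n) ξ‖ₑ ^ 2 := by
  have hu : AEStronglyMeasurable u volume := h.re.aestronglyMeasurable
  have hco : ∀ᵐ x, (h.toLp _ : L2 n) x = (u x : ℂ) := h.coeFn_toLp
  generalize (h.toLp _ : L2 n) = f at hco ⊢
  have h1 : ∀ y, ∫⁻ x, ‖u (x + y) - u x‖ₑ ^ 2 =
      ∫⁻ ξ, ‖phase y ξ - 1‖ₑ ^ 2 * ‖(𝓕 f : L2 n) ξ‖ₑ ^ 2 := by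
    intro y
    rw [← lintegral_translate_sub]
    refine lintegral_congr_ae ?_
    filter_upwards [hco, (measurePreserving_add_right (volume : Measure (Eucl n))
      y).quasiMeasurePreserving.ae hco] with x h1 h2
    rw [h1, h2, ← Complex.ofReal_sub, ← ofReal_norm, ← ofReal_norm, Complex.norm_real]
  rw [gag_eq_shear s hu]
  simp only [h1]
  exact lintegral_kern_mul_phase s
    ((Lp.stronglyMeasurable (𝓕 f : L2 n)).measurable.enorm.pow_const 2)

theorem memLp_ofReal_comp_iff {u : Eucl n → ℝ} :
    MemLp (fun x => (u x : ℂ)) 2 volume ↔ MemLp u 2 volume :=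
  ⟨fun h => h.re, fun h => h.ofReal⟩

theorem lintegral_sq_eq_fourier {u : Eucl n → ℝ} (h : MemLp (fun x => (u x : ℂ)) 2 volume) :
    ∫⁻ x, ‖u x‖ₑ ^ 2 = ∫⁻ ξ, ‖(𝓕 (h.toLp _) : L2 n) ξ‖ₑ ^ 2 := by
  have h1 : ‖(𝓕 (h.toLp _) : L2 n)‖ₑ ^ 2 = ‖(h.toLp _ : L2 n)‖ₑ ^ 2 := by
    rw [← ofReal_norm, ← ofReal_norm, Lp.norm_fourier_eq]
  rw [Lp_enorm_sq, Lp_enorm_sq] at h1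
  rw [h1]
  refine lintegral_congr_ae ?_
  filter_upwards [h.coeFn_toLp] with x hx
  rw [hx, ← ofReal_norm, ← ofReal_norm, Complex.norm_real]

theorem lintegral_sq_le_sobolevEnergy {s : ℝ} (hs : 0 ≤ s) {u : Eucl n → ℝ}
    (h : MemLp (fun x => (u x : ℂ)) 2 volume) :
    ∫⁻ x, ‖u x‖ₑ ^ 2 ≤ sobolevEnergy s (h.toLp _) := by
  rw [lintegral_sq_eq_fourier h, sobolevEnergy]
  refine lintegral_mono fun ξ => le_mul_of_one_le_left zero_le ?_
  rw [ENNReal.one_le_ofReal]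
  exact Real.one_le_rpow (by nlinarith [sq_nonneg ‖ξ‖]) hs

/-- On the Fourier side this is `|ξ|^{2s} ≤ (1+|ξ|²)ˢ`. -/
theorem exists_gag_le (hn : 1 ≤ n) {s : ℝ} (hs0 : 0 < s) (hs1 : s < 1) :
    ∃ C : ℝ≥0∞, C ≠ ⊤ ∧ ∀ (u : Eucl n → ℝ) (h : MemLp (fun x => (u x : ℂ)) 2 volume),
      gag s u ≤ C * sobolevEnergy s (h.toLp _) := by
  obtain ⟨c, hc0, hct, hc⟩ := exists_symb_eq hn hs0 hs1
  refine ⟨c, hct, fun u h => ?_⟩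
  rw [gag_eq_lintegral_symb s h, sobolevEnergy, ← lintegral_const_mul' _ _ hct]
  refine lintegral_mono fun ξ => ?_
  rw [hc, ← mul_assoc, mul_comm c]
  gcongr
  rw [Real.rpow_mul (norm_nonneg _), Real.rpow_ofNat]
  gcongr
  linarith

/-- On the Fourier side this is `(1+|ξ|²)ˢ ≤ 1 + |ξ|^{2s}`, the subadditivity of `t ↦ tˢ` for `0 ≤ s
≤ 1`. -/
theorem exists_sobolevEnergy_le (hn : 1 ≤ n) {s : ℝ} (hs0 : 0 < s) (hs1 : s < 1) :
    ∃ C : ℝ≥0∞, C ≠ ⊤ ∧ ∀ (u : Eucl n → ℝ) (h : MemLp (fun x => (u x : ℂ)) 2 volume),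
      sobolevEnergy s (h.toLp _) ≤ C * ((∫⁻ x, ‖u x‖ₑ ^ 2) + gag s u) := by
  obtain ⟨c, hc0, hct, hc⟩ := exists_symb_eq hn hs0 hs1
  refine ⟨1 + c⁻¹, by simp [hc0], fun u h => ?_⟩
  have hFm : Measurable fun ξ => ‖(𝓕 (h.toLp _) : L2 n) ξ‖ₑ ^ 2 :=
    (Lp.stronglyMeasurable (𝓕 (h.toLp _) : L2 n)).measurable.enorm.pow_const 2
  have hle : sobolevEnergy s (h.toLp _) ≤ (∫⁻ x, ‖u x‖ₑ ^ 2) + c⁻¹ * gag s u := by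
    rw [gag_eq_lintegral_symb s h, lintegral_sq_eq_fourier h, sobolevEnergy,
      ← lintegral_const_mul' _ _ (by simp [hc0]), ← lintegral_add_left hFm]
    refine lintegral_mono fun ξ => ?_
    rw [hc, ← mul_assoc, mul_comm (ENNReal.ofReal _) c, ← mul_assoc,
      ENNReal.inv_mul_cancel hc0 hct, one_mul]
    nth_rw 2 [← one_mul (‖_‖ₑ ^ 2)]
    rw [← add_mul, ← ENNReal.ofReal_one, ← ENNReal.ofReal_add zero_le_one (by positivity)]
    gcongr
    have := Real.rpow_add_le_add_rpow zero_le_one (sq_nonneg ‖ξ‖) hs0.le hs1.le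
    rwa [Real.one_rpow, ← Real.rpow_ofNat, ← Real.rpow_mul (norm_nonneg _), Real.rpow_ofNat] at this
  refine hle.trans ?_
  rw [mul_add]
  gcongr
  · exact le_mul_of_one_le_left zero_le le_self_add
  · exact le_add_self

theorem memHs_iff (hn : 1 ≤ n) {s : ℝ} (hs0 : 0 < s) (hs1 : s < 1) {u : Eucl n → ℝ} :
    MemHs s u ↔ MemLp u 2 volume ∧ gag s u < ⊤ := by
  rw [memHs_iff_sobolevEnergy hs0.le]
  constructor
  · rintro ⟨h, h'⟩
    obtain ⟨C, hC, hle⟩ := exists_gag_le hn hs0 hs1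
    exact ⟨memLp_ofReal_comp_iff.1 h, (hle u h).trans_lt (ENNReal.mul_lt_top hC.lt_top h')⟩
  · rintro ⟨h, h'⟩
    obtain ⟨C, hC, hle⟩ := exists_sobolevEnergy_le hn hs0 hs1
    refine ⟨memLp_ofReal_comp_iff.2 h, (hle u _).trans_lt (ENNReal.mul_lt_top hC.lt_top
      (ENNReal.add_lt_top.2 ⟨?_, h'⟩))⟩
    rw [← eLpNorm_two_sq]
    exact ENNReal.pow_lt_top h.eLpNorm_lt_top

theorem exists_hsNorm_sq_le (hn : 1 ≤ n) {s : ℝ} (hs0 : 0 < s) (hs1 : s < 1) :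
    ∃ C : ℝ≥0∞, C ≠ ⊤ ∧ ∀ u : Eucl n → ℝ, MemLp u 2 volume →
      hsNorm s u ^ 2 ≤ C * ((∫⁻ x, ‖u x‖ₑ ^ 2) + gag s u) := by
  obtain ⟨C, hC, hle⟩ := exists_sobolevEnergy_le hn hs0 hs1
  exact ⟨C, hC, fun u hu =>
    (hsNorm_sq_le hs0.le (memLp_ofReal_comp_iff.2 hu)).trans (hle u _)⟩

theorem exists_le_of_hsNorm_lt (hn : 1 ≤ n) {s : ℝ} (hs0 : 0 < s) (hs1 : s < 1) :
    ∃ C : ℝ≥0∞, C ≠ ⊤ ∧ ∀ (u : Eucl n → ℝ) (ε : ℝ≥0∞), hsNorm s u < ε →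
      MemLp u 2 volume ∧ ∫⁻ x, ‖u x‖ₑ ^ 2 ≤ ε ^ 2 ∧ gag s u ≤ C * ε ^ 2 := by
  obtain ⟨C, hC, hle⟩ := exists_gag_le hn hs0 hs1
  refine ⟨C, hC, fun u ε hu => ?_⟩
  obtain ⟨h, h'⟩ := exists_sobolevEnergy_lt hs0.le hu
  refine ⟨memLp_ofReal_comp_iff.1 h, (lintegral_sq_le_sobolevEnergy hs0.le h).trans h'.le,
    (hle u h).trans ?_⟩
  gcongr

/-! ### Estimates for the Gagliardo seminorm -/

/-- The contribution of distant points to the Gagliardo seminorm is controlled in `L²`. -/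
theorem exists_gag_far_le {s : ℝ} (hs0 : 0 < s) {ρ : ℝ} (hρ : 0 < ρ) :
    ∃ C : ℝ≥0∞, C ≠ ⊤ ∧ ∀ u : Eucl n → ℝ, Measurable u →
      ∫⁻ z in {z | z.1 - z.2 ∈ {h : Eucl n | ρ ≤ ‖h‖}}, ‖increment u z‖ₑ ^ 2 ∂(gagMeasure n s) ≤
        C * ∫⁻ x, ‖u x‖ₑ ^ 2 := by
  have hA : MeasurableSet {h : Eucl n | ρ ≤ ‖h‖} := measurableSet_le measurable_const
    measurable_norm
  have hfin := lintegral_kern_far_lt_top (n := n) hs0 hρ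
  refine ⟨(∫⁻ h in {h : Eucl n | ρ ≤ ‖h‖}, kern s h) * 4,
    ENNReal.mul_ne_top hfin.ne (by norm_num), fun u hu => ?_⟩
  rw [setLIntegral_gagMeasure_eq_shear s hA hu.aestronglyMeasurable, mul_assoc,
    ← lintegral_mul_const _ (measurable_kern s)]
  refine lintegral_mono fun h => ?_
  gcongr
  have hsq : ∀ a b : ℝ, ‖a - b‖ₑ ^ 2 ≤ 2 * ‖a‖ₑ ^ 2 + 2 * ‖b‖ₑ ^ 2 := by
    intro a b
    rw [← ofReal_norm, ← ofReal_norm, ← ofReal_norm, ← ENNReal.ofReal_pow (norm_nonneg _),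
      ← ENNReal.ofReal_pow (norm_nonneg _), ← ENNReal.ofReal_pow (norm_nonneg _),
      (by norm_num : (2 : ℝ≥0∞) = ENNReal.ofReal 2), ← ENNReal.ofReal_mul (by norm_num),
      ← ENNReal.ofReal_mul (by norm_num), ← ENNReal.ofReal_add (by positivity) (by positivity)]
    refine ENNReal.ofReal_le_ofReal ?_
    simp only [Real.norm_eq_abs, sq_abs]
    nlinarith [sq_nonneg (a + b)]
  calc ∫⁻ x, ‖u (x + h) - u x‖ₑ ^ 2
      ≤ ∫⁻ x, (2 * ‖u (x + h)‖ₑ ^ 2 + 2 * ‖u x‖ₑ ^ 2) := lintegral_mono fun x => hsq _ _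
    _ = 4 * ∫⁻ x, ‖u x‖ₑ ^ 2 := by
      rw [lintegral_add_left (by fun_prop), lintegral_const_mul _ (by fun_prop),
        lintegral_const_mul _ (by fun_prop),
        lintegral_add_right_eq_self (fun x => ‖u x‖ₑ ^ 2) h, ← add_mul]
      norm_num

/-- The seminorm gains a factor `t^{2s}` over the squared `L²` norm, which scales by `t^{-n}`; this
gap is what lets concentrated data isolate `γ(x₀)`. -/
theorem gag_comp_smul_sub {s : ℝ} {u : Eucl n → ℝ} (hu : Measurable u) {t : ℝ} (ht : 0 < t)
    (a : Eucl n) :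
    gag s (fun x => u (t • (x - a))) = ENNReal.ofReal (t ^ (2 * s)) *
      (ENNReal.ofReal ((t ^ n)⁻¹) * gag s u) := by
  rw [gag_eq_shear s hu.aestronglyMeasurable, gag_eq_shear s (u := fun x => u (t • (x - a)))
    (hu.comp (by fun_prop : Measurable fun x : Eucl n => t • (x - a))).aestronglyMeasurable]
  set G : Eucl n → ℝ≥0∞ := fun h => ∫⁻ x, ‖u (x + h) - u x‖ₑ ^ 2 with hG
  have h1 : ∀ h, ∫⁻ x, ‖u (t • (x + h - a)) - u (t • (x - a))‖ₑ ^ 2 =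
      ENNReal.ofReal ((t ^ n)⁻¹) * G (t • h) := by
    intro h
    rw [hG, ← lintegral_comp_smul_pos _ ht,
      ← lintegral_sub_right_eq_self (fun x => ‖u (t • x + t • h) - u (t • x)‖ₑ ^ 2) a]
    refine lintegral_congr fun x => ?_
    rw [← smul_add]
    congr 5
    abel
  simp only [h1]
  have h2 := lintegral_comp_smul_pos (fun h => kern s h * G h) ht
  simp only [kern_smul s ht, mul_assoc] at h2
  rw [lintegral_const_mul' _ _ ENNReal.ofReal_ne_top] at h2
  have h3 : ∫⁻ h, kern s h * G (t • h) = ENNReal.ofReal (t ^ ((n : ℝ) + 2 * s)) *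
      (ENNReal.ofReal (t ^ (-((n : ℝ) + 2 * s))) * ∫⁻ h, kern s h * G (t • h)) := by
    rw [← mul_assoc, ← ENNReal.ofReal_mul (by positivity), ← Real.rpow_add ht]
    simp
  simp only [mul_left_comm (kern s _)]
  rw [lintegral_const_mul' _ _ ENNReal.ofReal_ne_top, h3, h2, mul_left_comm, ← mul_assoc,
    ← mul_assoc, ← mul_assoc, ← ENNReal.ofReal_mul (by positivity),
    ← ENNReal.ofReal_mul (by positivity), ← ENNReal.ofReal_mul (by positivity)]
  congr 2
  rw [← Real.rpow_natCast, ← Real.rpow_neg ht.le, ← Real.rpow_add ht, ← Real.rpow_add ht,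
    ← Real.rpow_add ht]
  congr 1; ring

theorem lintegral_sq_comp_smul_sub (u : Eucl n → ℝ) {t : ℝ} (ht : 0 < t) (a : Eucl n) :
    ∫⁻ x, ‖u (t • (x - a))‖ₑ ^ 2 = ENNReal.ofReal ((t ^ n)⁻¹) * ∫⁻ x, ‖u x‖ₑ ^ 2 := by
  rw [lintegral_sub_right_eq_self (fun x => ‖u (t • x)‖ₑ ^ 2) a]
  exact lintegral_comp_smul_pos (fun x => ‖u x‖ₑ ^ 2) ht

/-- The fractional Poincaré inequality on a set disjoint from its translates by the vectors of
a ball. -/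
theorem exists_poincare (s : ℝ) {Ω : Set (Eucl n)} {a : Eucl n}
    (ha : ∀ x ∈ Ω, ∀ h ∈ Metric.ball a 1, x + h ∉ Ω) :
    ∃ C : ℝ≥0∞, C ≠ ⊤ ∧ ∀ u : Eucl n → ℝ, AEStronglyMeasurable u volume →
      (∀ᵐ x, x ∉ Ω → u x = 0) → ∫⁻ x, ‖u x‖ₑ ^ 2 ≤ C * gag s u := by
  rcases Ω.eq_empty_or_nonempty with rfl | ⟨x₀, hx₀⟩
  · refine ⟨0, ENNReal.zero_ne_top, fun u _ hu => ?_⟩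
    have h0 : (fun x => ‖u x‖ₑ ^ 2) =ᵐ[volume] 0 := by
      filter_upwards [hu] with x hx
      simp [hx]
    rw [lintegral_congr_ae h0]
    simp
  set c := ∫⁻ h in Metric.ball a 1, kern s h with hc
  have hc0 : c ≠ 0 := by
    rw [hc, Ne, lintegral_eq_zero_iff (measurable_kern s)]
    intro h0
    have hpos : 0 < volume (Metric.ball a 1) := Metric.measure_ball_pos _ _ one_pos
    refine hpos.ne' ?_
    rw [Filter.EventuallyEq, ae_restrict_iff' measurableSet_ball] at h0
    refine measure_mono_null ?_ (ae_iff.1 h0)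
    intro h hh hcon
    have h1 := hcon hh
    have h2 : h ≠ 0 := by
      rintro rfl
      exact ha x₀ hx₀ 0 hh (by simpa using hx₀)
    have h3 : 0 < ‖h‖ := norm_pos_iff.2 h2
    simp only [kern, Pi.zero_apply, ENNReal.ofReal_eq_zero] at h1
    have : 0 < ‖h‖ ^ (-((n : ℝ) + 2 * s)) := by positivity
    linarith
  -- The integral `c` may be infinite when the origin lies on the boundary of the ball; the
  -- truncation keeps the divisor finite and non-zero.
  refine ⟨(min c 1)⁻¹, by simp [hc0], fun u hu h0 => ?_⟩
  have hle : min c 1 * ∫⁻ x, ‖u x‖ₑ ^ 2 ≤ gag s u := by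
    grw [min_le_left]
    rw [gag_eq_shear s hu, hc, ← lintegral_mul_const _ (measurable_kern s)]
    refine (setLIntegral_mono' measurableSet_ball fun h hh => ?_).trans
      (setLIntegral_le_lintegral _ _)
    gcongr _ * ?_
    refine lintegral_mono_ae ?_
    filter_upwards [h0, (measurePreserving_add_right (volume : Measure (Eucl n))
      h).quasiMeasurePreserving.ae h0] with x h1 h2
    -- For `x ∈ Ω` the translate `x + h` lies outside `Ω`, so the difference is `-u(x)`.
    by_cases hx : x ∈ Ω
    · rw [h2 (ha x hx h hh), zero_sub, enorm_neg]
    · rw [h1 hx]; simp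
  rw [mul_comm, ← div_eq_mul_inv, ENNReal.le_div_iff_mul_le (by simp [hc0]) (by simp), mul_comm]
  exact hle

end FracCalderon

end

noncomputable section

namespace FracCalderon

variable {n : ℕ}

/-! ### Test functions and the spaces `Hˢ`, `H̃ˢ` -/

theorem IsTestFunction.memHs {U : Set (Eucl n)} {f : Eucl n → ℝ} (hf : IsTestFunction U f)
    (s : ℝ) : MemHs s f := by
  have hg₁ : HasCompactSupport (Complex.ofRealCLM ∘ f) := hf.2.1.comp_left rfl
  have hg₂ : ContDiff ℝ (((⊤ : ℕ∞) : WithTop ℕ∞)) (Complex.ofRealCLM ∘ f) :=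
    Complex.ofRealCLM.contDiff.comp hf.1
  set F : 𝓢(Eucl n, ℂ) := hg₁.toSchwartzMap hg₂
  have hF : ∀ x, F x = (f x : ℂ) := fun x => rfl
  refine ⟨⟨one_le_two⟩, (F : 𝓢'(Eucl n, ℂ)), fun φ => ⟨?_, ?_⟩, F.memSobolev⟩
  · have := (φ.memLp 2 volume).integrable_mul (F.memLp 2 volume)
    exact this
  · simp [hF]

theorem IsTestFunction.measurable {U : Set (Eucl n)} {f : Eucl n → ℝ}
    (hf : IsTestFunction U f) : Measurable f := hf.1.continuous.measurable

theorem IsTestFunction.eq_zero {U : Set (Eucl n)} {f : Eucl n → ℝ}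
    (hf : IsTestFunction U f) {x : Eucl n} (hx : x ∉ U) : f x = 0 :=
  image_eq_zero_of_notMem_tsupport fun h => hx (hf.2.2 h)

theorem IsTestFunction.mono {U V : Set (Eucl n)} {f : Eucl n → ℝ}
    (hf : IsTestFunction U f) (h : U ⊆ V) : IsTestFunction V f := ⟨hf.1, hf.2.1, hf.2.2.trans h⟩

theorem isTestFunction_zero (U : Set (Eucl n)) : IsTestFunction U (0 : Eucl n → ℝ) :=
  ⟨contDiff_const, HasCompactSupport.zero, by simp [tsupport]⟩

theorem IsTestFunction.add {U : Set (Eucl n)} {f g : Eucl n → ℝ} (hf : IsTestFunction U f)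
    (hg : IsTestFunction U g) : IsTestFunction U (f + g) :=
  ⟨hf.1.add hg.1, hf.2.1.add hg.2.1,
    (tsupport_add f g).trans (Set.union_subset hf.2.2 hg.2.2)⟩

theorem IsTestFunction.const_smul {U : Set (Eucl n)} {f : Eucl n → ℝ} (hf : IsTestFunction U f)
    (c : ℝ) : IsTestFunction U (c • f) := by
  have hsub : tsupport (c • f) ⊆ tsupport f := closure_mono (Function.support_const_smul_subset c f)
  exact ⟨hf.1.const_smul c, hf.2.1.mono' (subset_tsupport _ |>.trans hsub), hsub.trans hf.2.2⟩

theorem increment_add (u v : Eucl n → ℝ) :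
    increment (u + v) = increment u + increment v := by
  ext z; simp [increment]; ring

theorem increment_sub (u v : Eucl n → ℝ) :
    increment (fun x => u x - v x) = increment u - increment v := by
  ext z; simp [increment]; ring

theorem increment_smul (c : ℝ) (u : Eucl n → ℝ) :
    increment (c • u) = c • increment u := by
  ext z; simp [increment]; ring

theorem memLp_increment_iff {s : ℝ} {u : Eucl n → ℝ} (hu : AEStronglyMeasurable u volume) :
    MemLp (increment u) 2 (gagMeasure n s) ↔ gag s u < ⊤ := by
  have hm : AEStronglyMeasurable (increment u) (gagMeasure n s) :=
    (aestronglyMeasurable_increment hu).mono_ac (gagMeasure_absolutelyContinuous s)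
  rw [gag, ← eLpNorm_two_sq]
  constructor
  · intro h
    exact ENNReal.pow_lt_top h.eLpNorm_lt_top
  · intro h
    exact ⟨hm, (ENNReal.pow_lt_top_iff.1 h).resolve_right two_ne_zero⟩

theorem memHs_iff_memLp (hn : 1 ≤ n) {s : ℝ} (hs0 : 0 < s) (hs1 : s < 1) {u : Eucl n → ℝ} :
    MemHs s u ↔ MemLp u 2 volume ∧ MemLp (increment u) 2 (gagMeasure n s) := by
  rw [memHs_iff hn hs0 hs1]
  exact and_congr_right fun h => (memLp_increment_iff h.aestronglyMeasurable).symm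

theorem MemHs.add (hn : 1 ≤ n) {s : ℝ} (hs0 : 0 < s) (hs1 : s < 1) {u v : Eucl n → ℝ}
    (hu : MemHs s u) (hv : MemHs s v) : MemHs s (u + v) := by
  rw [memHs_iff_memLp hn hs0 hs1] at *
  rw [increment_add]
  exact ⟨hu.1.add hv.1, hu.2.add hv.2⟩

/-- `v` is an `L²` limit of test functions that vanish off `Ω`. -/
theorem MemHsTilde.eq_zero_outside (hn : 1 ≤ n) {s : ℝ} (hs0 : 0 < s) (hs1 : s < 1)
    {Ω : Set (Eucl n)} (hΩ : MeasurableSet Ω) {v : Eucl n → ℝ} (hv : MemHsTilde s Ω v) :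
    ∀ᵐ x, x ∉ Ω → v x = 0 := by
  obtain ⟨C, hC, hle⟩ := exists_le_of_hsNorm_lt hn hs0 hs1
  have hvm : AEStronglyMeasurable v volume :=
    ((memHs_iff hn hs0 hs1).1 hv.1).1.aestronglyMeasurable
  have h1 : ∫⁻ x in Ωᶜ, ‖v x‖ₑ ^ 2 = 0 := by
    have h2 : ∀ ε : ℝ≥0∞, 0 < ε → ∫⁻ x in Ωᶜ, ‖v x‖ₑ ^ 2 ≤ ε ^ 2 := by
      intro ε hε
      obtain ⟨φ, hφ, hlt⟩ := hv.2 ε hε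
      refine le_trans ?_ (hle _ ε hlt).2.1
      refine (setLIntegral_mono' hΩ.compl fun x hx => ?_).trans (setLIntegral_le_lintegral Ωᶜ _)
      rw [hφ.eq_zero hx, sub_zero]
    have h3 : Tendsto (fun ε : ℝ≥0∞ => ε ^ 2) (𝓝[>] 0) (𝓝 0) := by
      have := (ENNReal.continuous_pow 2).tendsto (0 : ℝ≥0∞)
      simp only [ne_eq, OfNat.ofNat_ne_zero, not_false_eq_true, zero_pow] at this
      exact this.mono_left nhdsWithin_le_nhds
    exact le_antisymm (ge_of_tendsto h3 (eventually_mem_nhdsWithin.mono h2)) zero_le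
  rw [lintegral_eq_zero_iff' ((hvm.enorm.pow_const 2).restrict), EventuallyEq,
    ae_restrict_iff' hΩ.compl] at h1
  filter_upwards [h1] with x hx hxΩ
  simpa using hx hxΩ

/-! ### Existence of weak solutions -/

theorem Lp_enorm_sub_sq {α : Type*} [MeasurableSpace α] {μ : Measure α} {f g : Lp ℝ 2 μ}
    {f' g' : α → ℝ} (hf : f =ᵐ[μ] f') (hg : g =ᵐ[μ] g') :
    ‖f - g‖ₑ ^ 2 = ∫⁻ x, ‖f' x - g' x‖ₑ ^ 2 ∂μ := by
  rw [Lp_enorm_sq]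
  refine lintegral_congr_ae ?_
  filter_upwards [hf, hg, Lp.coeFn_sub f g] with x h1 h2 h3
  rw [h3, Pi.sub_apply, h1, h2]

/-- The increments of test functions, as a subspace of an `L²` space on `ℝ²ⁿ`. -/
def incrementSubmodule (ν : Measure (Eucl n × Eucl n)) (Ω : Set (Eucl n)) :
    Submodule ℝ (Lp ℝ 2 ν) where
  carrier := {p | ∃ ψ, IsTestFunction Ω ψ ∧ p =ᵐ[ν] increment ψ}
  add_mem' := by
    rintro p q ⟨ψ, hψ, hp⟩ ⟨χ, hχ, hq⟩
    refine ⟨ψ + χ, hψ.add hχ, ?_⟩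
    rw [increment_add]
    exact (Lp.coeFn_add p q).trans (hp.add hq)
  zero_mem' := ⟨0, isTestFunction_zero Ω, by
    have h0 : increment (0 : Eucl n → ℝ) = 0 := by ext z; simp [increment]
    rw [h0]
    exact Lp.coeFn_zero ℝ 2 ν⟩
  smul_mem' := by
    rintro c p ⟨ψ, hψ, hp⟩
    refine ⟨c • ψ, hψ.const_smul c, ?_⟩
    rw [increment_smul]
    exact (Lp.coeFn_smul c p).trans (hp.const_smul c)

theorem lintegral_le_of_le_smul {α : Type*} [MeasurableSpace α] {μ ν : Measure α} {C : ℝ≥0∞}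
    (h : ν ≤ C • μ) (f : α → ℝ≥0∞) : ∫⁻ x, f x ∂ν ≤ C * ∫⁻ x, f x ∂μ := by
  rw [← smul_eq_mul, ← lintegral_smul_measure]
  exact lintegral_mono' h le_rfl

variable {s : ℝ} {ν : Measure (Eucl n × Eucl n)} {Ω : Set (Eucl n)}

theorem MemHsTilde.toLp_increment_mem_closure (hn : 1 ≤ n) (hs0 : 0 < s) (hs1 : s < 1)
    {C : ℝ≥0∞} (hC : C ≠ ⊤) (hν : ν ≤ C • gagMeasure n s) {v : Eucl n → ℝ}
    (hv : MemHsTilde s Ω v) (hm : MemLp (increment v) 2 ν) :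
    hm.toLp _ ∈ (incrementSubmodule ν Ω).topologicalClosure := by
  obtain ⟨C', hC', hle⟩ := exists_le_of_hsNorm_lt hn hs0 hs1
  have hseq : ∀ ε : ℝ≥0∞, 0 < ε → ∃ q ∈ incrementSubmodule ν Ω,
      ‖hm.toLp _ - q‖ₑ ^ 2 ≤ C * (C' * ε ^ 2) := by
    intro ε hε
    obtain ⟨φ, hφ, hlt⟩ := hv.2 ε hε
    have hφm : MemLp (increment φ) 2 ν :=
      (((memHs_iff_memLp hn hs0 hs1).1 (hφ.memHs s)).2).of_measure_le_smul hC hν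
    refine ⟨hφm.toLp _, ⟨φ, hφ, hφm.coeFn_toLp⟩, ?_⟩
    rw [Lp_enorm_sub_sq hm.coeFn_toLp hφm.coeFn_toLp]
    refine (lintegral_le_of_le_smul hν _).trans ?_
    gcongr
    refine le_trans (le_of_eq ?_) (hle _ ε hlt).2.2
    rw [gag, increment_sub]
    rfl
  rw [← SetLike.mem_coe, Submodule.topologicalClosure_coe, EMetric.mem_closure_iff]
  intro δ hδ
  have ht : Tendsto (fun ε : ℝ≥0∞ => C * (C' * ε ^ 2)) (𝓝[>] 0) (𝓝 0) := by
    have h1 : Tendsto (fun ε : ℝ≥0∞ => ε ^ 2) (𝓝[>] 0) (𝓝 0) := by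
      have := (ENNReal.continuous_pow 2).tendsto (0 : ℝ≥0∞)
      simp only [ne_eq, OfNat.ofNat_ne_zero, not_false_eq_true, zero_pow] at this
      exact this.mono_left nhdsWithin_le_nhds
    have h2 := ENNReal.Tendsto.const_mul (a := C) (ENNReal.Tendsto.const_mul (a := C') h1
      (Or.inr hC')) (Or.inr hC)
    simpa using h2
  have hδ2 : (0 : ℝ≥0∞) < δ ^ 2 := by positivity
  obtain ⟨ε, hε, hε0⟩ := ((ht.eventually (gt_mem_nhds hδ2)).and eventually_mem_nhdsWithin).exists
  obtain ⟨q, hq, hq'⟩ := hseq ε hε0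
  refine ⟨q, hq, ?_⟩
  rw [edist_eq_enorm_sub]
  exact lt_of_pow_lt_pow_left' 2 (hq'.trans_lt hε)

/-- By Poincaré, test functions whose increments converge in `L²(ν)` are Cauchy in `L²(ℝⁿ)`. Passing
to a.e. convergent subsequences identifies the limit of the increments with the increment of the
limit, and comparability of `ν` with `gagMeasure` upgrades the convergence to `Hˢ`. -/
theorem exists_memHsTilde_of_mem_closure (hn : 1 ≤ n) (hs0 : 0 < s) (hs1 : s < 1)
    {C : ℝ≥0∞} (hν : ν ≤ C • gagMeasure n s)
    {C' : ℝ≥0∞} (hC' : C' ≠ ⊤) (hν' : gagMeasure n s ≤ C' • ν) {a : Eucl n}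
    (ha : ∀ x ∈ Ω, ∀ h ∈ Metric.ball a 1, x + h ∉ Ω) {p : Lp ℝ 2 ν}
    (hp : p ∈ (incrementSubmodule ν Ω).topologicalClosure) :
    ∃ v, MemHsTilde s Ω v ∧ p =ᵐ[ν] increment v := by
  rw [← SetLike.mem_coe, Submodule.topologicalClosure_coe, mem_closure_iff_seq_limit] at hp
  obtain ⟨x, hxM, hx⟩ := hp
  choose ψ hψ hxψ using hxM
  obtain ⟨P, hP, hpoin⟩ := exists_poincare s ha
  have hψL : ∀ j, MemLp (ψ j) 2 volume := fun j =>
    ((memHs_iff hn hs0 hs1).1 ((hψ j).memHs s)).1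
  set L : ℕ → Lp ℝ 2 (volume : Measure (Eucl n)) := fun j => (hψL j).toLp _ with hL
  have hLψ : ∀ j, L j =ᵐ[volume] ψ j := fun j => (hψL j).coeFn_toLp
  have hdiff : ∀ i j, ‖L i - L j‖ₑ ^ 2 ≤ P * (C' * ‖x i - x j‖ₑ ^ 2) := by
    intro i j
    rw [Lp_enorm_sub_sq (hLψ i) (hLψ j), Lp_enorm_sub_sq (hxψ i) (hxψ j)]
    refine (hpoin (fun y => ψ i y - ψ j y) ((hψL i).sub (hψL j)).aestronglyMeasurable
      (ae_of_all _ fun y hy => ?_)).trans ?_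
    · rw [(hψ i).eq_zero hy, (hψ j).eq_zero hy, sub_zero]
    · gcongr
      rw [gag, increment_sub]
      exact lintegral_le_of_le_smul hν' _
  have hdist : ∀ i j, dist (L i) (L j) ≤ √((P * C').toReal) * dist (x i) (x j) := by
    intro i j
    have h1 := ENNReal.toReal_mono (ENNReal.mul_ne_top hP (ENNReal.mul_ne_top hC' (by simp)))
      (hdiff i j)
    rw [← mul_assoc, ENNReal.toReal_mul, ENNReal.toReal_pow, ENNReal.toReal_pow, toReal_enorm,
      toReal_enorm] at h1
    rw [dist_eq_norm, dist_eq_norm]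
    refine le_of_sq_le_sq ?_ (by positivity)
    rwa [mul_pow, Real.sq_sqrt ENNReal.toReal_nonneg]
  have hcau : CauchySeq L := by
    obtain ⟨b, hb0, hb, hbt⟩ := cauchySeq_iff_le_tendsto_0.1 hx.cauchySeq
    refine cauchySeq_iff_le_tendsto_0.2 ⟨fun N => √((P * C').toReal) * b N,
      fun N => mul_nonneg (Real.sqrt_nonneg _) (hb0 N), fun i j N hi hj => ?_,
      by simpa using hbt.const_mul (√((P * C').toReal))⟩
    exact (hdist i j).trans (mul_le_mul_of_nonneg_left (hb i j N hi hj) (Real.sqrt_nonneg _))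
  obtain ⟨V, hV⟩ := cauchySeq_tendsto_of_complete hcau
  have hνvol : ν ≪ (volume : Measure (Eucl n × Eucl n)) :=
    (Measure.absolutelyContinuous_of_le_smul hν).trans (gagMeasure_absolutelyContinuous s)
  have hpV : p =ᵐ[ν] increment V := by
    obtain ⟨ns, hns, hns'⟩ := (tendstoInMeasure_of_tendsto_Lp hx).exists_seq_tendsto_ae
    obtain ⟨ms, hms, hms'⟩ := (tendstoInMeasure_of_tendsto_Lp
      (hV.comp hns.tendsto_atTop)).exists_seq_tendsto_ae
    have hall : ∀ᵐ y, ∀ j, L j y = ψ j y := ae_all_iff.2 hLψ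
    have hcv : ∀ᵐ y, Tendsto (fun i => ψ (ns (ms i)) y) atTop (𝓝 (V y)) := by
      filter_upwards [hms', hall] with y h1 h2
      simpa only [Function.comp_apply, h2] using h1
    have hallx : ∀ᵐ z ∂ν, ∀ j, x j z = increment (ψ j) z := ae_all_iff.2 hxψ
    filter_upwards [hns', hallx, hνvol.ae_le (ae_fst hcv), hνvol.ae_le (ae_snd hcv)]
      with z h1 h2 h3 h4
    simp only [h2] at h1
    exact tendsto_nhds_unique (h1.comp hms.tendsto_atTop) (h3.sub h4)
  have hVL : MemLp V 2 volume := Lp.memLp V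
  have hVH : MemHs s V := (memHs_iff_memLp hn hs0 hs1).2 ⟨hVL,
    ((memLp_congr_ae hpV).1 (Lp.memLp p)).of_measure_le_smul hC' hν'⟩
  refine ⟨V, ⟨hVH, fun ε hε => ?_⟩, hpV⟩
  obtain ⟨D, hD, hDle⟩ := exists_hsNorm_sq_le hn hs0 hs1
  have hbound : ∀ j, hsNorm s (fun y => V y - ψ j y) ^ 2 ≤
      D * (‖V - L j‖ₑ ^ 2 + C' * ‖p - x j‖ₑ ^ 2) := by
    intro j
    refine (hDle (fun y => V y - ψ j y) (hVL.sub (hψL j))).trans ?_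
    rw [Lp_enorm_sub_sq EventuallyEq.rfl (hLψ j), Lp_enorm_sub_sq hpV (hxψ j)]
    refine mul_le_mul_right (add_le_add le_rfl ?_) D
    rw [gag, increment_sub]
    exact lintegral_le_of_le_smul hν' _
  have hto : ∀ {F : Type} [NormedAddCommGroup F] {g : ℕ → F} {b : F}, Tendsto g atTop (𝓝 b) →
      Tendsto (fun j => ‖b - g j‖ₑ ^ 2) atTop (𝓝 0) := by
    intro F _ g b hg
    have h1 : Tendsto (fun j => edist b (g j)) atTop (𝓝 0) := by
      simpa [edist_comm] using tendsto_iff_edist_tendsto_0.1 hg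
    simp only [edist_eq_enorm_sub] at h1
    have h2 := ((ENNReal.continuous_pow 2).tendsto 0).comp h1
    rwa [zero_pow two_ne_zero] at h2
  have hlim : Tendsto (fun j => D * (‖V - L j‖ₑ ^ 2 + C' * ‖p - x j‖ₑ ^ 2)) atTop (𝓝 0) := by
    have h2 := ENNReal.Tendsto.const_mul (a := D) ((hto hV).add
      (ENNReal.Tendsto.const_mul (a := C') (hto hx) (Or.inr hC'))) (Or.inr hD)
    simpa using h2
  have hε2 : (0 : ℝ≥0∞) < ε ^ 2 := by positivity
  obtain ⟨j, hj⟩ := (hlim.eventually (gt_mem_nhds hε2)).exists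
  exact ⟨ψ j, hψ j, lt_of_pow_lt_pow_left' 2 ((hbound j).trans_lt hj)⟩

/-- Well-posedness of the exterior value problem: existence. -/
theorem exists_weak_solution (hn : 1 ≤ n) (hs0 : 0 < s) (hs1 : s < 1)
    {C : ℝ≥0∞} (hC : C ≠ ⊤) (hν : ν ≤ C • gagMeasure n s)
    {C' : ℝ≥0∞} (hC' : C' ≠ ⊤) (hν' : gagMeasure n s ≤ C' • ν) {a : Eucl n}
    (ha : ∀ x ∈ Ω, ∀ h ∈ Metric.ball a 1, x + h ∉ Ω) {f : Eucl n → ℝ} (hf : MemHs s f) :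
    ∃ u, MemHs s u ∧ MemHsTilde s Ω (fun x => u x - f x) ∧
      ∀ φ, MemHsTilde s Ω φ → ∫ z, increment u z * increment φ z ∂ν = 0 := by
  have hfm : MemLp (increment f) 2 ν :=
    (((memHs_iff_memLp hn hs0 hs1).1 hf).2).of_measure_le_smul hC hν
  set K := (incrementSubmodule ν Ω).topologicalClosure with hK
  have : CompleteSpace K := (Submodule.isClosed_topologicalClosure _).completeSpace_coe
  set F : Lp ℝ 2 ν := hfm.toLp _
  -- The correction `v` has as increment the projection of `-F` onto `K`, which makes the increment
  -- of `f + v` orthogonal to `K`.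
  have hpK : K.starProjection (-F) ∈ K := Submodule.starProjection_apply_mem K (-F)
  have hperp : -F - K.starProjection (-F) ∈ Kᗮ := Submodule.sub_starProjection_mem_orthogonal (-F)
  obtain ⟨v, hv, hpv⟩ := exists_memHsTilde_of_mem_closure hn hs0 hs1 hν hC' hν' ha hpK
  refine ⟨f + v, hf.add hn hs0 hs1 hv.1, by simpa using hv, fun φ hφ => ?_⟩
  have hφm : MemLp (increment φ) 2 ν :=
    (((memHs_iff_memLp hn hs0 hs1).1 hφ.1).2).of_measure_le_smul hC hν
  have h0 := Submodule.inner_left_of_mem_orthogonal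
    (hφ.toLp_increment_mem_closure hn hs0 hs1 hC hν hφm) hperp
  rw [L2.inner_def] at h0
  rw [← neg_eq_zero, ← integral_neg, ← h0]
  refine integral_congr_ae ?_
  filter_upwards [hφm.coeFn_toLp, hpv, hfm.coeFn_toLp, Lp.coeFn_sub (-F) (K.starProjection (-F)),
    Lp.coeFn_neg F] with z h1 h2 h3 h4 h5
  rw [h1, h4, Pi.sub_apply, h2, h5, Pi.neg_apply, h3, increment_add]
  simp
  ring

end FracCalderon

end

/-! ### Domains bounded in one direction, conductivity energies and localized data -/

noncomputable section

namespace FracCalderon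

variable {n : ℕ}

open scoped RealInnerProductSpace

/-- A set that is bounded in one direction is disjoint from its translates by the vectors of some
unit ball. -/
theorem BoundedInOneDirection.exists_translation {Ω : Set (Eucl n)}
    (hΩ : BoundedInOneDirection Ω) :
    ∃ a : Eucl n, ∀ x ∈ Ω, ∀ h ∈ Metric.ball a 1, x + h ∉ Ω := by
  obtain ⟨k, hk, D, A, hk0, -, hD, hsub⟩ := hΩ
  obtain ⟨R, hR⟩ := hD.exists_norm_le
  set j : Fin n := ⟨n - k + ((⟨0, hk0⟩ : Fin k) : ℕ), by simp only; omega⟩ with hj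
  have hcoord : ∀ x ∈ cylinderDomain hk D, |x j| ≤ R := by
    intro x hx
    refine le_trans ?_ (hR _ hx)
    exact PiLp.norm_apply_le (WithLp.toLp 2 (fun i : Fin k => x ⟨n - k + i, by omega⟩)) ⟨0, hk0⟩
  -- Before the rigid motion, `j`-th coordinates of points of `Ω` differ by at most `2R`, while
  -- every vector within distance 1 of this one shifts that coordinate by more than `2R + 1`.
  refine ⟨A.linearIsometryEquiv (EuclideanSpace.single j (2 * R + 2)), fun x hx h hh hxh => ?_⟩
  obtain ⟨x', hx', rfl⟩ := hsub hx
  obtain ⟨y', hy', hy⟩ := hsub hxh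
  set w := A.linearIsometryEquiv.symm h with hw
  have hwh : h = A.linearIsometryEquiv w := by simp [hw]
  have hy2 : y' = w + x' := by
    apply A.injective
    rw [hy, ← vadd_eq_add w x', A.map_vadd, vadd_eq_add, ← hwh, add_comm]
  have h1 : ‖w - EuclideanSpace.single j (2 * R + 2)‖ < 1 := by
    rw [mem_ball_iff_norm, hwh, ← map_sub, LinearIsometryEquiv.norm_map] at hh
    exact hh
  have h2 := (PiLp.norm_apply_le (w - EuclideanSpace.single j (2 * R + 2)) j).trans_lt h1
  have h3 := hcoord _ hx'
  have h4 := hcoord _ hy'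
  rw [hy2] at h4
  simp only [PiLp.sub_apply, PiLp.single_apply, if_true, PiLp.add_apply,
    Real.norm_eq_abs] at h2 h4
  rw [abs_lt] at h2
  rw [abs_le] at h3 h4
  linarith [h2.1, h3.1, h4.2]

/-! ### The measure associated with a conductivity -/

theorem fracConst_pos (hn : 1 ≤ n) {s : ℝ} (hs0 : 0 < s) (hs1 : s < 1) : 0 < fracConst n s := by
  have h1 : 0 < Real.Gamma ((n : ℝ) / 2 + s) := Real.Gamma_pos_of_pos (by positivity)
  have h2 : Real.Gamma (-s) ≠ 0 := by
    refine Real.Gamma_ne_zero fun m => ?_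
    rcases m with _ | m
    · simp [hs0.ne']
    · intro h
      have : (0 : ℝ) ≤ m := m.cast_nonneg
      push_cast at h
      linarith
  have h3 : 0 < |Real.Gamma (-s)| := abs_pos.2 h2
  rw [fracConst]
  positivity

/-- The density of the energy of `γ` with respect to `|x-y|^{-(n+2s)} dx dy`. -/
def condDensity (s : ℝ) (γ : Eucl n → ℝ) (z : Eucl n × Eucl n) : ℝ :=
  fracConst n s / 2 * (√(γ z.1) * √(γ z.2))

/-- The measure on `ℝ²ⁿ` with `B_γ(u,v) = ∫ (u(x)-u(y))(v(x)-v(y))`. -/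
def condMeasure (s : ℝ) (γ : Eucl n → ℝ) : Measure (Eucl n × Eucl n) :=
  (gagMeasure n s).withDensity fun z => ENNReal.ofReal (condDensity s γ z)

theorem condDensity_nonneg (hn : 1 ≤ n) {s : ℝ} (hs0 : 0 < s) (hs1 : s < 1) (γ : Eucl n → ℝ)
    (z : Eucl n × Eucl n) : 0 ≤ condDensity s γ z := by
  have := fracConst_pos hn hs0 hs1
  unfold condDensity
  positivity

theorem aemeasurable_condDensity (s : ℝ) {γ : Eucl n → ℝ} (hγ : AEMeasurable γ volume) :
    AEMeasurable (condDensity s γ) (gagMeasure n s) := by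
  have h1 : AEMeasurable (fun z : Eucl n × Eucl n => γ z.1) volume :=
    hγ.comp_quasiMeasurePreserving Measure.quasiMeasurePreserving_fst
  have h2 : AEMeasurable (fun z : Eucl n × Eucl n => γ z.2) volume :=
    hγ.comp_quasiMeasurePreserving Measure.quasiMeasurePreserving_snd
  exact ((h1.sqrt.mul h2.sqrt).const_mul _).mono_ac (gagMeasure_absolutelyContinuous s)

theorem integral_condMeasure (hn : 1 ≤ n) {s : ℝ} (hs0 : 0 < s) (hs1 : s < 1) {γ : Eucl n → ℝ}
    (hγ : AEMeasurable γ volume) (F : Eucl n × Eucl n → ℝ) :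
    ∫ z, F z ∂(condMeasure s γ) = ∫ z, condDensity s γ z * F z ∂(gagMeasure n s) := by
  rw [condMeasure, integral_withDensity_eq_integral_toReal_smul₀
    (aemeasurable_condDensity s hγ).ennreal_ofReal (ae_of_all _ fun z => ENNReal.ofReal_lt_top)]
  refine integral_congr_ae (ae_of_all _ fun z => ?_)
  simp only [ENNReal.toReal_ofReal (condDensity_nonneg hn hs0 hs1 γ z), smul_eq_mul]

theorem condForm_eq (hn : 1 ≤ n) {s : ℝ} (hs0 : 0 < s) (hs1 : s < 1) {γ : Eucl n → ℝ}
    (hγ : AEMeasurable γ volume) (u v : Eucl n → ℝ) :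
    condForm s γ u v = ∫ z, increment u z * increment v z ∂(condMeasure s γ) := by
  rw [integral_condMeasure hn hs0 hs1 hγ, gagMeasure, integral_withDensity_eq_integral_toReal_smul
    (measurable_kern_sub s) (ae_of_all _ fun z => ENNReal.ofReal_lt_top), condForm]
  refine integral_congr_ae (ae_of_all _ fun z => ?_)
  have hc := (fracConst_pos hn hs0 hs1).le
  simp only [kern, ENNReal.toReal_ofReal (Real.rpow_nonneg (norm_nonneg _) _), fracGrad,
    real_inner_smul_left, real_inner_smul_right, real_inner_self_eq_norm_sq, condDensity,
    increment, smul_eq_mul]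
  rcases eq_or_ne z.1 z.2 with h | h
  · simp [h]
  have hp : 0 < ‖z.1 - z.2‖ := norm_pos_iff.2 (sub_ne_zero.2 h)
  have hpow : ‖z.1 - z.2‖ ^ (-((n : ℝ) + 2 * s)) =
      ‖z.1 - z.2‖ ^ 2 / (‖z.1 - z.2‖ ^ ((n : ℝ) / 2 + s + 1)) ^ 2 := by
    rw [← Real.rpow_natCast, ← Real.rpow_natCast, ← Real.rpow_mul hp.le, ← Real.rpow_sub hp]
    congr 1; push_cast; ring
  have hsq : √(fracConst n s / 2) ^ 2 = fracConst n s / 2 := Real.sq_sqrt (by positivity)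
  rw [hpow]
  generalize √(fracConst n s / 2) = q at hsq
  rw [← hsq]
  field_simp

theorem MemLp.exists_ae_le_of_top {γ : Eucl n → ℝ} (hγ : MemLp γ ⊤ volume) :
    ∃ M : ℝ, 0 ≤ M ∧ ∀ᵐ x, γ x ≤ M := by
  refine ⟨(eLpNorm γ ⊤ volume).toReal, ENNReal.toReal_nonneg, ?_⟩
  have h := ae_le_eLpNormEssSup (f := γ) (μ := volume)
  filter_upwards [h] with x hx
  rw [← eLpNorm_exponent_top] at hx
  have := ENNReal.toReal_mono hγ.eLpNorm_lt_top.ne hx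
  rw [toReal_enorm] at this
  exact (le_abs_self _).trans this

theorem condMeasure_le (hn : 1 ≤ n) {s : ℝ} (hs0 : 0 < s) (hs1 : s < 1) {γ : Eucl n → ℝ} {M : ℝ}
    (hM0 : 0 ≤ M) (hM : ∀ᵐ x, γ x ≤ M) :
    condMeasure s γ ≤ ENNReal.ofReal (fracConst n s / 2 * M) • gagMeasure n s := by
  have hc := (fracConst_pos hn hs0 hs1).le
  rw [← withDensity_const]
  refine withDensity_mono ?_
  filter_upwards [(gagMeasure_absolutelyContinuous s).ae_le (ae_fst hM),
    (gagMeasure_absolutelyContinuous s).ae_le (ae_snd hM)] with z h1 h2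
  refine ENNReal.ofReal_le_ofReal ?_
  unfold condDensity
  gcongr
  calc √(γ z.1) * √(γ z.2) ≤ √M * √M := by gcongr
    _ = M := Real.mul_self_sqrt hM0

/-- Ellipticity: together with `condMeasure_le` it makes the energy of `γ` equivalent to the
Gagliardo seminorm. -/
theorem gagMeasure_le (hn : 1 ≤ n) {s : ℝ} (hs0 : 0 < s) (hs1 : s < 1) {γ : Eucl n → ℝ} {γ₀ : ℝ}
    (h0 : 0 < γ₀) (hγ : ∀ᵐ x, γ₀ ≤ γ x) :
    gagMeasure n s ≤ (ENNReal.ofReal (fracConst n s / 2 * γ₀))⁻¹ • condMeasure s γ := by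
  have hc := fracConst_pos hn hs0 hs1
  have h1 : ENNReal.ofReal (fracConst n s / 2 * γ₀) • gagMeasure n s ≤ condMeasure s γ := by
    rw [← withDensity_const]
    refine withDensity_mono ?_
    filter_upwards [(gagMeasure_absolutelyContinuous s).ae_le (ae_fst hγ),
      (gagMeasure_absolutelyContinuous s).ae_le (ae_snd hγ)] with z h1 h2
    refine ENNReal.ofReal_le_ofReal ?_
    unfold condDensity
    gcongr
    calc γ₀ = √γ₀ * √γ₀ := (Real.mul_self_sqrt h0.le).symm
      _ ≤ √(γ z.1) * √(γ z.2) := by gcongr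
  have hne : ENNReal.ofReal (fracConst n s / 2 * γ₀) ≠ 0 :=
    (ENNReal.ofReal_pos.2 (by positivity)).ne'
  calc gagMeasure n s = (ENNReal.ofReal (fracConst n s / 2 * γ₀))⁻¹ •
      (ENNReal.ofReal (fracConst n s / 2 * γ₀) • gagMeasure n s) := by
        rw [smul_smul, ENNReal.inv_mul_cancel hne ENNReal.ofReal_ne_top, one_smul]
    _ ≤ _ := by gcongr

/-! ### Localized boundary data -/

/-- Here `a` is the increment of the correction `v`, `c` that of the data and `b` the part of `c` on
distant pairs. Orthogonality gives `‖a‖² = -⟪a, b⟫`, hence `‖a‖ ≤ ‖b‖`, and the cross term `⟪a, c⟫ =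
⟪a, b⟫` is at most `‖b‖²`. -/
theorem abs_inner_add_sub_le {H : Type*} [NormedAddCommGroup H] [InnerProductSpace ℝ H]
    {a b c : H} (h1 : ⟪a + c, a⟫ = 0) (h2 : ⟪a, c⟫ = ⟪a, b⟫) :
    |⟪a + c, c⟫ - ⟪c, c⟫| ≤ ‖b‖ ^ 2 := by
  have h3 : ‖a‖ ^ 2 = -⟪a, b⟫ := by
    rw [inner_add_left, real_inner_self_eq_norm_sq, real_inner_comm] at h1
    linarith
  have h4 := abs_real_inner_le_norm a b
  have h5 : ‖a‖ ≤ ‖b‖ := by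
    by_contra! h
    have h6 : ‖a‖ ^ 2 ≤ ‖a‖ * ‖b‖ := h3.le.trans ((neg_le_abs _).trans h4)
    nlinarith [norm_nonneg a, norm_nonneg b]
  rw [inner_add_left, add_sub_cancel_right, h2]
  nlinarith [norm_nonneg a, norm_nonneg b]

/-- The set of pairs of points at distance at least `r`. -/
def farPairs (n : ℕ) (r : ℝ) : Set (Eucl n × Eucl n) :=
  {z | z.1 - z.2 ∈ {h : Eucl n | r ≤ ‖h‖}}

theorem measurableSet_farPairs (r : ℝ) : MeasurableSet (farPairs n r) :=
  (measurable_fst.sub measurable_snd) (measurableSet_le measurable_const measurable_norm)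

/-- One of the two points lies in the ball of radius `r`, and the other is closer than `r` to it. -/
theorem mem_ball_of_increment_ne_zero {f : Eucl n → ℝ} {x₀ : Eucl n} {r : ℝ}
    (hf : ∀ x, x ∉ Metric.ball x₀ r → f x = 0) {z : Eucl n × Eucl n} (hz : z ∉ farPairs n r)
    (h : increment f z ≠ 0) :
    z.1 ∈ Metric.ball x₀ (2 * r) ∧ z.2 ∈ Metric.ball x₀ (2 * r) := by
  have hz' : dist z.1 z.2 < r := by
    rw [dist_eq_norm]
    simpa [farPairs] using hz
  have hor : z.1 ∈ Metric.ball x₀ r ∨ z.2 ∈ Metric.ball x₀ r := by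
    by_contra! hcon
    exact h (by rw [increment, hf _ hcon.1, hf _ hcon.2, sub_zero])
  simp only [Metric.mem_ball] at *
  have h1 := dist_triangle z.1 z.2 x₀
  have h2 := dist_triangle_left z.2 x₀ z.1
  have h3 := dist_nonneg (x := z.1) (y := z.2)
  rcases hor with h | h
  · constructor <;> linarith
  · constructor <;> linarith

/-- The DN map of data supported in a ball away from `Ω` is the energy of the data up to the
interaction of distant points. -/
theorem abs_weak_solution_sub_energy_le {ν : Measure (Eucl n × Eucl n)}
    (hνvol : ν ≪ (volume : Measure (Eucl n × Eucl n))) {x₀ : Eucl n} {r : ℝ} {f v : Eucl n → ℝ}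
    (hf : ∀ x, x ∉ Metric.ball x₀ r → f x = 0) (hfm : MemLp (increment f) 2 ν)
    (hv : ∀ᵐ x, x ∈ Metric.ball x₀ (2 * r) → v x = 0) (hvm : MemLp (increment v) 2 ν)
    (hsol : ∫ z, increment (v + f) z * increment v z ∂ν = 0) :
    |∫ z, increment (v + f) z * increment f z ∂ν - ∫ z, increment f z * increment f z ∂ν| ≤
      (∫⁻ z in farPairs n r, ‖increment f z‖ₑ ^ 2 ∂ν).toReal := by
  have hT := measurableSet_farPairs (n := n) r
  have hbm : MemLp ((farPairs n r).indicator (increment f)) 2 ν := hfm.indicator hT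
  have hin : ∀ {g h : Eucl n × Eucl n → ℝ} (hg : MemLp g 2 ν) (hh : MemLp h 2 ν),
      ⟪hg.toLp g, hh.toLp h⟫ = ∫ z, g z * h z ∂ν := by
    intro g h hg hh
    rw [L2.inner_def]
    refine integral_congr_ae ?_
    filter_upwards [hg.coeFn_toLp, hh.coeFn_toLp] with z h1 h2
    rw [h1, h2]
    simp [mul_comm]
  have hsum : hvm.toLp _ + hfm.toLp _ = (hvm.add hfm).toLp _ := (MemLp.toLp_add hvm hfm).symm
  have key := abs_inner_add_sub_le (a := hvm.toLp _) (b := hbm.toLp _) (c := hfm.toLp _) ?_ ?_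
  · rw [hsum, hin, hin, ← increment_add] at key
    refine key.trans (le_of_eq ?_)
    rw [← toReal_enorm, ← ENNReal.toReal_pow, Lp_enorm_sq, ← lintegral_indicator hT]
    congr 1
    refine lintegral_congr_ae ?_
    filter_upwards [hbm.coeFn_toLp] with z hz
    rw [hz]
    by_cases h : z ∈ farPairs n r <;> simp [h]
  · rw [hsum, hin, ← increment_add]
    exact hsol
  · rw [hin, hin]
    refine integral_congr_ae ?_
    filter_upwards [hνvol.ae_le (ae_fst hv), hνvol.ae_le (ae_snd hv)] with z h1 h2
    -- At near pairs where the increment of `f` is non-zero both points lie in the ball of radius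
    -- `2r`, where `v` vanishes.
    by_cases hz : z ∈ farPairs n r
    · simp [hz]
    · simp only [hz, not_false_eq_true, Set.indicator_of_notMem, mul_zero]
      by_cases hne : increment f z = 0
      · simp [hne]
      · obtain ⟨h3, h4⟩ := mem_ball_of_increment_ne_zero hf hz hne
        rw [increment, h1 h3, h2 h4, sub_zero, zero_mul]

end FracCalderon

end

/-! ### Asymptotics of the DN map on concentrated data -/

noncomputable section

namespace FracCalderon

variable {n : ℕ}

theorem integral_mul_self_eq_toReal {α : Type*} [MeasurableSpace α] {μ : Measure α} {g : α → ℝ}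
    (hg : AEStronglyMeasurable g μ) :
    ∫ z, g z * g z ∂μ = (∫⁻ z, ‖g z‖ₑ ^ 2 ∂μ).toReal := by
  rw [integral_eq_lintegral_of_nonneg_ae (ae_of_all _ fun z => mul_self_nonneg _) (hg.mul hg)]
  congr 1
  refine lintegral_congr fun z => ?_
  rw [← ofReal_norm, ← ENNReal.ofReal_pow (norm_nonneg _), Real.norm_eq_abs, sq_abs, sq]

/-- Near a point of continuity of `γ`, the energy of localized data is, up to the interaction of
distant points, proportional to the Gagliardo seminorm. -/
theorem abs_energy_sub_le (hn : 1 ≤ n) {s : ℝ} (hs0 : 0 < s) (hs1 : s < 1) {γ : Eucl n → ℝ}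
    (hγ : AEMeasurable γ volume) {M : ℝ} (hM0 : 0 ≤ M) (hM : ∀ᵐ x, γ x ≤ M) {x₀ : Eucl n}
    {r η g : ℝ} (hη0 : 0 ≤ η) (hη : ∀ x ∈ Metric.ball x₀ (2 * r), ∀ y ∈ Metric.ball x₀ (2 * r),
      |√(γ x) * √(γ y) - g| ≤ η) {f : Eucl n → ℝ}
    (hf : ∀ x, x ∉ Metric.ball x₀ r → f x = 0) (hfm : MemLp (increment f) 2 (gagMeasure n s)) :
    |∫ z, increment f z * increment f z ∂(condMeasure s γ) - fracConst n s / 2 * g *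
        ∫ z, increment f z * increment f z ∂(gagMeasure n s)| ≤
      fracConst n s / 2 * η * ∫ z, increment f z * increment f z ∂(gagMeasure n s) +
        fracConst n s / 2 * (M + |g|) *
          (∫⁻ z in farPairs n r, ‖increment f z‖ₑ ^ 2 ∂(gagMeasure n s)).toReal := by
  have hκ : 0 < fracConst n s / 2 := half_pos (fracConst_pos hn hs0 hs1)
  set κ := fracConst n s / 2 with hκd
  have hT := measurableSet_farPairs (n := n) r
  have hF : Integrable (fun z => increment f z * increment f z) (gagMeasure n s) :=
    hfm.integrable_mul hfm
  have hb : ∀ᵐ z ∂(gagMeasure n s), √(γ z.1) * √(γ z.2) ≤ M := by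
    filter_upwards [(gagMeasure_absolutelyContinuous s).ae_le (ae_fst hM),
      (gagMeasure_absolutelyContinuous s).ae_le (ae_snd hM)] with z h1 h2
    calc √(γ z.1) * √(γ z.2) ≤ √M * √M := by gcongr
      _ = M := Real.mul_self_sqrt hM0
  have hwF : Integrable (fun z => condDensity s γ z * (increment f z * increment f z))
      (gagMeasure n s) := by
    refine (hF.const_mul (κ * M)).mono'
      ((aemeasurable_condDensity s hγ).aestronglyMeasurable.mul hF.aestronglyMeasurable) ?_
    filter_upwards [hb] with z hz
    rw [Real.norm_of_nonneg (mul_nonneg (condDensity_nonneg hn hs0 hs1 γ z) (mul_self_nonneg _)),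
      condDensity]
    gcongr
    exact mul_self_nonneg _
  have hfar : (∫⁻ z in farPairs n r, ‖increment f z‖ₑ ^ 2 ∂(gagMeasure n s)).toReal =
      ∫ z, (farPairs n r).indicator (fun z => increment f z * increment f z) z ∂(gagMeasure n s) := by
    rw [integral_indicator hT, ← integral_mul_self_eq_toReal hfm.aestronglyMeasurable.restrict]
  rw [integral_condMeasure hn hs0 hs1 hγ, hfar, ← integral_const_mul, ← integral_const_mul,
    ← integral_const_mul, ← integral_sub hwF (hF.const_mul _),
    ← integral_add (hF.const_mul _) ((hF.indicator hT).const_mul _), ← Real.norm_eq_abs]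
  refine norm_integral_le_of_norm_le ((hF.const_mul _).add ((hF.indicator hT).const_mul _)) ?_
  filter_upwards [hb] with z hz
  have hd : condDensity s γ z * (increment f z * increment f z) -
      κ * g * (increment f z * increment f z) =
      κ * ((√(γ z.1) * √(γ z.2) - g) * (increment f z * increment f z)) := by
    rw [condDensity]; ring
  have hsq : 0 ≤ increment f z * increment f z := mul_self_nonneg _
  rw [hd, Real.norm_eq_abs, abs_mul, abs_mul, abs_of_pos hκ, abs_of_nonneg hsq, mul_assoc, mul_assoc,
    ← mul_add]
  gcongr
  -- Distant pairs only allow the crude bound `M + |g|`; at near pairs the oscillation bound `η`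
  -- applies.
  by_cases hz2 : z ∈ farPairs n r
  · rw [Set.indicator_of_mem hz2]
    have h1 : |√(γ z.1) * √(γ z.2) - g| ≤ M + |g| := by
      refine (abs_sub _ _).trans ?_
      rw [abs_of_nonneg (by positivity)]
      gcongr
    rw [← add_mul]
    exact mul_le_mul_of_nonneg_right (h1.trans (le_add_of_nonneg_left hη0)) hsq
  · rw [Set.indicator_of_notMem hz2, mul_zero, add_zero]
    by_cases hne : increment f z = 0
    · simp [hne]
    · obtain ⟨h3, h4⟩ := mem_ball_of_increment_ne_zero hf hz2 hne
      exact mul_le_mul_of_nonneg_right (hη _ h3 _ h4) hsq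

/-- In a ball, the Gagliardo seminorm is not controlled by the `L²` norm. -/
theorem not_gag_le_of_ball (hn : 1 ≤ n) {s : ℝ} (hs0 : 0 < s) (hs1 : s < 1) (x₀ : Eucl n)
    {r : ℝ} (hr : 0 < r) (C : ℝ) :
    ∃ f, IsTestFunction (Metric.ball x₀ r) f ∧
      C * (∫⁻ x, ‖f x‖ₑ ^ 2).toReal < (gag s f).toReal := by
  let b : ContDiffBump (0 : Eucl n) := ⟨r / 4, r / 2, by positivity, by linarith⟩
  have hbt : IsTestFunction (Metric.ball (0 : Eucl n) r) b := by
    refine ⟨b.contDiff, b.hasCompactSupport, ?_⟩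
    rw [b.tsupport_eq]
    exact Metric.closedBall_subset_ball (by simp only [b]; linarith)
  have hbm := hbt.measurable
  obtain ⟨hb2, hbg⟩ := (memHs_iff hn hs0 hs1).1 (hbt.memHs s)
  have hNfin : ∫⁻ x, ‖b x‖ₑ ^ 2 ≠ ⊤ := by
    rw [← eLpNorm_two_sq]
    exact (ENNReal.pow_lt_top hb2.eLpNorm_lt_top).ne
  have hNpos : ∫⁻ x, ‖b x‖ₑ ^ 2 ≠ 0 := by
    rw [Ne, lintegral_eq_zero_iff (hbm.enorm.pow_const 2)]
    intro h
    refine (Metric.measure_ball_pos (volume : Measure (Eucl n)) 0 b.rOut_pos).ne'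
      (measure_mono_null ?_ (ae_iff.1 h))
    intro x hx hx0
    have := b.pos_of_mem_ball hx
    simp [this.ne'] at hx0
  have hE : 0 < (gag s b).toReal := by
    refine ENNReal.toReal_pos (fun h0 => hNpos ?_) hbg.ne
    have : Nontrivial (Eucl n) := Module.nontrivial_of_finrank_pos (R := ℝ) (by simp; omega)
    -- A translation of length more than `2r` moves the ball off itself; with length `2r + 1` there
    -- is room for the unit ball of translations that Poincaré requires.
    obtain ⟨a, ha⟩ := exists_norm_eq (Eucl n) (by positivity : (0 : ℝ) ≤ 2 * r + 1)
    obtain ⟨P, hP, hle⟩ := exists_poincare (Ω := Metric.ball (0 : Eucl n) r) (a := a) s (by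
      intro x hx h hh hxh
      rw [mem_ball_zero_iff] at hx hxh
      rw [mem_ball_iff_norm] at hh
      have h1 : a = (x + h) - x - (h - a) := by abel
      have h2 : ‖a‖ ≤ ‖x + h‖ + ‖x‖ + ‖h - a‖ := by
        conv_lhs => rw [h1]
        exact (norm_sub_le _ _).trans (add_le_add_left (norm_sub_le _ _) _)
      linarith)
    have := hle b hbm.aestronglyMeasurable (ae_of_all _ fun x hx => hbt.eq_zero hx)
    rw [h0, mul_zero] at this
    exact le_antisymm this zero_le
  obtain ⟨t, ht1, ht⟩ : ∃ t : ℝ, 1 ≤ t ∧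
      C * (∫⁻ x, ‖b x‖ₑ ^ 2).toReal < t ^ (2 * s) * (gag s b).toReal := by
    have h1 : Tendsto (fun t : ℝ => t ^ (2 * s) * (gag s b).toReal) atTop atTop :=
      (tendsto_rpow_atTop (by positivity)).atTop_mul_const hE
    exact ((eventually_ge_atTop 1).and (h1.eventually_gt_atTop _)).exists
  have ht0 : 0 < t := one_pos.trans_le ht1
  refine ⟨fun x => b (t • (x - x₀)), ⟨?_, ?_, ?_⟩, ?_⟩
  · exact b.contDiff.comp (by fun_prop : ContDiff ℝ _ fun x : Eucl n => t • (x - x₀))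
  · refine HasCompactSupport.of_support_subset_isCompact
      (isCompact_closedBall x₀ (r / 2)) fun x hx => ?_
    have h1 : t • (x - x₀) ∈ Function.support b := hx
    rw [b.support_eq, mem_ball_zero_iff, norm_smul, Real.norm_of_nonneg ht0.le] at h1
    rw [mem_closedBall_iff_norm]
    have h2 : t * ‖x - x₀‖ < r / 2 := h1
    nlinarith [norm_nonneg (x - x₀)]
  · refine (closure_minimal (fun x hx => ?_) Metric.isClosed_closedBall).trans
      (Metric.closedBall_subset_ball (by linarith : r / 2 < r))
    have h1 : t • (x - x₀) ∈ Function.support b := hx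
    rw [b.support_eq, mem_ball_zero_iff, norm_smul, Real.norm_of_nonneg ht0.le] at h1
    rw [mem_closedBall_iff_norm]
    have h2 : t * ‖x - x₀‖ < r / 2 := h1
    nlinarith [norm_nonneg (x - x₀)]
  · rw [lintegral_sq_comp_smul_sub _ ht0, gag_comp_smul_sub hbm ht0, ENNReal.toReal_mul,
      ENNReal.toReal_mul, ENNReal.toReal_mul, ENNReal.toReal_ofReal (by positivity),
      ENNReal.toReal_ofReal (by positivity)]
    have h1 : 0 < (t ^ n)⁻¹ := by positivity
    nlinarith

/-- A lower bound valid almost everywhere holds at the interior points of continuity. -/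
theorem le_of_ae_le_of_continuousOn {γ : Eucl n → ℝ} {γ₀ : ℝ} (h0 : ∀ᵐ x, γ₀ ≤ γ x)
    {W : Set (Eucl n)} (hW : IsOpen W) (hc : ContinuousOn γ W) {x : Eucl n} (hx : x ∈ W) :
    γ₀ ≤ γ x := by
  by_contra! h
  have h1 : ∀ᶠ y in 𝓝 x, γ y < γ₀ := (hc.continuousAt (hW.mem_nhds hx)).eventually (gt_mem_nhds h)
  obtain ⟨U, hU, hUo, hxU⟩ := eventually_nhds_iff.1 h1
  refine (hUo.measure_pos volume ⟨x, hxU⟩).ne' (measure_mono_null ?_ (ae_iff.1 h0))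
  intro y hy
  exact not_le.2 (hU y hy)

/-- The DN map determines the conductivity at an exterior point up to an error of lower order. -/
theorem exists_abs_dnMap_sub_le (hn : 1 ≤ n) {s : ℝ} (hs0 : 0 < s) (hs1 : s < 1)
    {Ω : Set (Eucl n)} (hΩ : IsOpen Ω) (hΩb : BoundedInOneDirection Ω) {γ : Eucl n → ℝ}
    (hγ : MemLp γ ⊤ volume) {γ₀ : ℝ} (hγ₀ : 0 < γ₀) (hγ0 : ∀ᵐ x, γ₀ ≤ γ x) {x₀ : Eucl n}
    {r η : ℝ} (hr : 0 < r) (hη0 : 0 ≤ η) (hrΩ : Disjoint (Metric.ball x₀ (2 * r)) Ω)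
    (hη : ∀ x ∈ Metric.ball x₀ (2 * r), ∀ y ∈ Metric.ball x₀ (2 * r),
      |√(γ x) * √(γ y) - γ x₀| ≤ η) :
    ∃ C : ℝ, ∀ f, IsTestFunction (Metric.ball x₀ r) f →
      |dnMap s γ Ω f f - fracConst n s / 2 * γ x₀ * (gag s f).toReal| ≤
        fracConst n s / 2 * η * (gag s f).toReal + C * (∫⁻ x, ‖f x‖ₑ ^ 2).toReal := by
  have hγm : AEMeasurable γ volume := hγ.aestronglyMeasurable.aemeasurable
  obtain ⟨M, hM0, hM⟩ := MemLp.exists_ae_le_of_top hγ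
  obtain ⟨a, ha⟩ := hΩb.exists_translation
  obtain ⟨D, hD, hfar⟩ := exists_gag_far_le (n := n) hs0 hr
  have hκ : 0 < fracConst n s / 2 := half_pos (fracConst_pos hn hs0 hs1)
  have hν := condMeasure_le hn hs0 hs1 hM0 hM
  have hν' := gagMeasure_le hn hs0 hs1 hγ₀ hγ0
  have hC' : (ENNReal.ofReal (fracConst n s / 2 * γ₀))⁻¹ ≠ ⊤ :=
    ENNReal.inv_ne_top.2 (ENNReal.ofReal_pos.2 (by positivity)).ne'
  have hνvol : condMeasure s γ ≪ (volume : Measure (Eucl n × Eucl n)) :=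
    (Measure.absolutelyContinuous_of_le_smul hν).trans (gagMeasure_absolutelyContinuous s)
  -- The first summand bounds the cross term with the correction, the second the effect of distant
  -- pairs on the energy of `f`.
  refine ⟨fracConst n s / 2 * M * D.toReal + fracConst n s / 2 * (M + |γ x₀|) * D.toReal,
    fun f hf => ?_⟩
  have hfH : MemHs s f := hf.memHs s
  obtain ⟨hf2, hfg⟩ := (memHs_iff_memLp hn hs0 hs1).1 hfH
  have hNfin : ∫⁻ x, ‖f x‖ₑ ^ 2 ≠ ⊤ := by
    rw [← eLpNorm_two_sq]
    exact (ENNReal.pow_lt_top hf2.eLpNorm_lt_top).ne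
  have hfν : MemLp (increment f) 2 (condMeasure s γ) :=
    hfg.of_measure_le_smul ENNReal.ofReal_ne_top hν
  have hf0 : ∀ x, x ∉ Metric.ball x₀ r → f x = 0 := fun x hx => hf.eq_zero hx
  -- `solution` is a choice, so existence is what makes it a weak solution; the estimate holds for
  -- any weak solution, so uniqueness plays no role.
  have hex : ∃ u, IsWeakSolution s γ Ω f u := by
    obtain ⟨u, h1, h2, h3⟩ := exists_weak_solution hn hs0 hs1 ENNReal.ofReal_ne_top hν hC' hν' ha hfH
    exact ⟨u, h1, h2, fun φ hφ => by rw [condForm_eq hn hs0 hs1 hγm]; exact h3 φ hφ⟩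
  obtain ⟨-, hu2, hu3⟩ : IsWeakSolution s γ Ω f (solution s γ Ω f) := Classical.epsilon_spec hex
  set u := solution s γ Ω f with hu
  have huv : u = (fun x => u x - f x) + f := by ext x; simp
  have hvm : MemLp (increment fun x => u x - f x) 2 (condMeasure s γ) :=
    (((memHs_iff_memLp hn hs0 hs1).1 hu2.1).2).of_measure_le_smul ENNReal.ofReal_ne_top hν
  have hv0 : ∀ᵐ x, x ∈ Metric.ball x₀ (2 * r) → u x - f x = 0 := by
    filter_upwards [hu2.eq_zero_outside hn hs0 hs1 hΩ.measurableSet] with x hx hxb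
    exact hx (Set.disjoint_left.1 hrΩ hxb)
  have hsol := hu3 _ hu2
  rw [condForm_eq hn hs0 hs1 hγm] at hsol
  nth_rw 1 [huv] at hsol
  have key1 := abs_weak_solution_sub_energy_le hνvol hf0 hfν hv0 hvm hsol
  rw [← huv, ← condForm_eq hn hs0 hs1 hγm] at key1
  have key2 := abs_energy_sub_le hn hs0 hs1 hγm hM0 hM hη0 hη hf0 hfg
  have hE : ∫ z, increment f z * increment f z ∂(gagMeasure n s) = (gag s f).toReal :=
    integral_mul_self_eq_toReal hfg.aestronglyMeasurable
  rw [hE] at key2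
  have hq : (∫⁻ z in farPairs n r, ‖increment f z‖ₑ ^ 2 ∂(gagMeasure n s)).toReal ≤
      D.toReal * (∫⁻ x, ‖f x‖ₑ ^ 2).toReal := by
    rw [← ENNReal.toReal_mul]
    exact ENNReal.toReal_mono (ENNReal.mul_ne_top hD hNfin) (hfar f hf.measurable)
  have hq' : (∫⁻ z in farPairs n r, ‖increment f z‖ₑ ^ 2 ∂(condMeasure s γ)).toReal ≤
      fracConst n s / 2 * M * (D.toReal * (∫⁻ x, ‖f x‖ₑ ^ 2).toReal) := by
    rw [← ENNReal.toReal_ofReal (by positivity : 0 ≤ fracConst n s / 2 * M), ← ENNReal.toReal_mul,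
      ← ENNReal.toReal_mul]
    refine ENNReal.toReal_mono (ENNReal.mul_ne_top ENNReal.ofReal_ne_top
      (ENNReal.mul_ne_top hD hNfin)) ?_
    refine (lintegral_le_of_le_smul (μ := (gagMeasure n s).restrict (farPairs n r)) ?_ _).trans
      (mul_le_mul_right (hfar f hf.measurable) _)
    rw [← Measure.restrict_smul]
    exact Measure.restrict_mono_measure hν _
  have hq2 : fracConst n s / 2 * (M + |γ x₀|) *
      (∫⁻ z in farPairs n r, ‖increment f z‖ₑ ^ 2 ∂(gagMeasure n s)).toReal ≤
      fracConst n s / 2 * (M + |γ x₀|) * (D.toReal * (∫⁻ x, ‖f x‖ₑ ^ 2).toReal) := by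
    gcongr
  have htri := abs_sub_le (condForm s γ u f)
    (∫ z, increment f z * increment f z ∂(condMeasure s γ))
    (fracConst n s / 2 * γ x₀ * (gag s f).toReal)
  rw [dnMap, ← hu]
  linarith

theorem exists_ball_sqrt_mul_sqrt_sub_le {γ : Eucl n → ℝ} {x₀ : Eucl n} (hc : ContinuousAt γ x₀)
    (h0 : 0 ≤ γ x₀) {η : ℝ} (hη : 0 < η) :
    ∃ δ > 0, ∀ x ∈ Metric.ball x₀ δ, ∀ y ∈ Metric.ball x₀ δ, |√(γ x) * √(γ y) - γ x₀| ≤ η := by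
  have hs : ContinuousAt (fun x => √(γ x)) x₀ := hc.sqrt
  have h1 : Tendsto (fun p : Eucl n × Eucl n => √(γ p.1) * √(γ p.2)) (𝓝 x₀ ×ˢ 𝓝 x₀)
      (𝓝 (γ x₀)) := by
    have := (hs.tendsto.comp tendsto_fst).mul (hs.tendsto.comp (tendsto_snd (f := 𝓝 x₀)))
    rwa [Real.mul_self_sqrt h0] at this
  have h2 := h1.eventually (Metric.closedBall_mem_nhds (γ x₀) hη)
  obtain ⟨p, hp, q, hq, hpq⟩ := Filter.eventually_prod_iff.1 h2
  obtain ⟨δ, hδ, hball⟩ := Metric.eventually_nhds_iff_ball.1 (hp.and hq)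
  refine ⟨δ, hδ, fun x hx y hy => ?_⟩
  have := hpq (hball x hx).1 (hball y hy).2
  rwa [Real.dist_eq] at this

end FracCalderon

end

/-! ### Determination of the conductivity in the exterior -/

theorem theorem1p2 (n : ℕ) (s : ℝ) (hs0 : 0 < s) (hs1 : s < min 1 ((n : ℝ) / 2))
    (Ω : Set (FracCalderon.Eucl n)) (hΩ : IsOpen Ω)
    (hΩb : FracCalderon.BoundedInOneDirection Ω)
    (γ₁ γ₂ : FracCalderon.Eucl n → ℝ)
    (hγ₁ : MemLp γ₁ ∞ volume) (hγ₂ : MemLp γ₂ ∞ volume)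
    (γ₀ : ℝ) (hγ₀ : 0 < γ₀)
    (hγ₁0 : ∀ᵐ x ∂volume, γ₀ ≤ γ₁ x) (hγ₂0 : ∀ᵐ x ∂volume, γ₀ ≤ γ₂ x)
    (hm₁ : FracCalderon.MemBessel (2 * s) (ENNReal.ofReal ((n : ℝ) / (2 * s)))
      (FracCalderon.backgroundDeviation γ₁))
    (hm₂ : FracCalderon.MemBessel (2 * s) (ENNReal.ofReal ((n : ℝ) / (2 * s)))
      (FracCalderon.backgroundDeviation γ₂))
    (W : Set (FracCalderon.Eucl n)) (hW : IsOpen W) (hWne : W.Nonempty)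
    (hWΩ : W ⊆ FracCalderon.exterior Ω)
    (hcont₁ : ContinuousOn γ₁ W) (hcont₂ : ContinuousOn γ₂ W)
    (hΛ : ∀ f, FracCalderon.IsTestFunction W f → ∀ g, FracCalderon.IsTestFunction W g →
      FracCalderon.dnMap s γ₁ Ω f g = FracCalderon.dnMap s γ₂ Ω f g) :
    ∀ x ∈ W, γ₁ x = γ₂ x := by
  intro x₀ hx₀
  have hs1' : s < 1 := hs1.trans_le (min_le_left _ _)
  have hn : 1 ≤ n := by
    have h := hs1.trans_le (min_le_right _ _)
    have : (0 : ℝ) < n := by linarith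
    exact_mod_cast this
  by_contra hne
  set d := |γ₁ x₀ - γ₂ x₀| with hd
  have hdpos : 0 < d := abs_pos.2 (sub_ne_zero.2 hne)
  have hp₁ := FracCalderon.le_of_ae_le_of_continuousOn hγ₁0 hW hcont₁ hx₀
  have hp₂ := FracCalderon.le_of_ae_le_of_continuousOn hγ₂0 hW hcont₂ hx₀
  -- With oscillation `d/4` for each conductivity, the two errors together absorb only half of the
  -- main term `κ d E`.
  obtain ⟨δ₁, hδ₁, hb₁⟩ := FracCalderon.exists_ball_sqrt_mul_sqrt_sub_le
    (hcont₁.continuousAt (hW.mem_nhds hx₀)) (hγ₀.le.trans hp₁) (by positivity : 0 < d / 4)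
  obtain ⟨δ₂, hδ₂, hb₂⟩ := FracCalderon.exists_ball_sqrt_mul_sqrt_sub_le
    (hcont₂.continuousAt (hW.mem_nhds hx₀)) (hγ₀.le.trans hp₂) (by positivity : 0 < d / 4)
  obtain ⟨δ₃, hδ₃, hb₃⟩ := Metric.isOpen_iff.1 hW x₀ hx₀
  obtain ⟨r, hr, hr₁, hr₂, hr₃⟩ : ∃ r > 0, 2 * r ≤ δ₁ ∧ 2 * r ≤ δ₂ ∧ 2 * r ≤ δ₃ := by
    refine ⟨min δ₁ (min δ₂ δ₃) / 2, by positivity, ?_, ?_, ?_⟩ <;>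
      rw [mul_div_cancel₀ _ two_ne_zero] <;> simp
  have hrW : Metric.ball x₀ (2 * r) ⊆ W := (Metric.ball_subset_ball hr₃).trans hb₃
  have hrΩ : Disjoint (Metric.ball x₀ (2 * r)) Ω :=
    Set.disjoint_left.2 fun x hx hxΩ => hWΩ (hrW hx) (subset_closure hxΩ)
  obtain ⟨C₁, hC₁⟩ := FracCalderon.exists_abs_dnMap_sub_le hn hs0 hs1' hΩ hΩb hγ₁ hγ₀ hγ₁0 hr
    (by positivity) hrΩ
    fun x hx y hy => hb₁ x (Metric.ball_subset_ball hr₁ hx) y (Metric.ball_subset_ball hr₁ hy)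
  obtain ⟨C₂, hC₂⟩ := FracCalderon.exists_abs_dnMap_sub_le hn hs0 hs1' hΩ hΩb hγ₂ hγ₀ hγ₂0 hr
    (by positivity) hrΩ
    fun x hx y hy => hb₂ x (Metric.ball_subset_ball hr₂ hx) y (Metric.ball_subset_ball hr₂ hy)
  have hκ := half_pos (FracCalderon.fracConst_pos hn hs0 hs1')
  set κ := FracCalderon.fracConst n s / 2
  -- The two estimates leave `κ d / 2 · E ≤ (C₁ + C₂) N`, which this choice of `f` violates.
  obtain ⟨f, hf, hlt⟩ := FracCalderon.not_gag_le_of_ball hn hs0 hs1' x₀ hr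
    ((C₁ + C₂) / (κ * d / 2))
  have hfW : FracCalderon.IsTestFunction W f :=
    hf.mono ((Metric.ball_subset_ball (by linarith)).trans hrW)
  have h₁ := hC₁ f hf
  have h₂ := hC₂ f hf
  rw [hΛ f hfW f hfW] at h₁
  set E := (FracCalderon.gag s f).toReal
  set N := (∫⁻ x, ‖f x‖ₑ ^ 2).toReal
  have hE0 : 0 ≤ E := ENNReal.toReal_nonneg
  have h3 : |κ * γ₁ x₀ * E - κ * γ₂ x₀ * E| = κ * d * E := by
    rw [← sub_mul, ← mul_sub, abs_mul, abs_mul, abs_of_pos hκ, abs_of_nonneg hE0]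
  have h4 := abs_sub_le (κ * γ₁ x₀ * E) (FracCalderon.dnMap s γ₂ Ω f f) (κ * γ₂ x₀ * E)
  rw [h3, abs_sub_comm (κ * γ₁ x₀ * E)] at h4
  rw [div_mul_eq_mul_div, div_lt_iff₀ (by positivity)] at hlt
  nlinarith
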